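/- Let $n,m\ge 1$ be integers and let $A,Q,W\in\mathbb R^{n\times n}$, $B\in\mathbb R^{n\times m}$, $R\in\mathbb R^{m\times m}$. Fix one of the two time settings, continuous time (CT) or discrete time (DT). A matrix $M\in\mathbb R^{n\times n}$ is called stable if all its eigenvalues have negative real part (CT), respectively if its spectral radius is less than $1$ (DT). Let $\mathcal K=\{K\in\mathbb R^{m\times n} : A+BK \text{ is stable}\}$. On symmetric block matrices with $n\times n$ blocks set $$\Psi\left(\begin{bmatrix}F&G\\G^{\mathsf T}&H\end{bmatrix}\right)=G+G^{\mathsf T}\ \text{(CT)},\qquad \Psi\left(\begin{bmatrix}F&G\\G^{\mathsf T}&H\end{bmatrix}\right)=F-H\ \text{(DT)},$$ and call a symmetric $X\in\mathbb R^{n\times n}$ a Lyapunov solution for $K\in\mathbb R^{m\times n}$ if $$\Psi\left(\begin{bmatrix}A+BK\\I\end{bmatrix}X\begin{bmatrix}A+BK\\I\end{bmatrix}^{\mathsf T}\right)+W=0 .$$ Assume: 1. $Q\succeq 0$, $Q\neq 0$; $R\succ 0$; $W\succeq 0$, $W\ne 0$; $(A,B)$ is stabilizable ($A+BK$ is stable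 for some $K$) and $(Q^{1/2},A)$ is detectable ($A+LQ^{1/2}$ is stable for some $L\in\mathbb R^{n\times n}$). 2. For every $K\in\mathbb R^{m\times n}$ and every Lyapunov solution $X$ for $K$: $K\in\mathcal K$ if and only if $X\succ 0$. Then every $K\in\mathcal K$ has a unique Lyapunov solution $X_K$, and the cost $J(K)=\langle Q+K^{\mathsf T}RK,X_K\rangle$ (with $\langle M,N\rangle=\operatorname{Tr}(M^{\mathsf T}N)$) is differentiable at every $K\in\mathcal K$ and has a unique minimizer $K^\star$ over $\mathcal K$. Write $J^\star=J(K^\star)=\min_{K\in\mathcal K}J(K)$ and $X^\star=X_{K^\star}$. For every $K\in\mathcal K$, $$\mu_K\,\bigl(J(K)-J^\star\bigr)\le\|\nabla J(K)\|_F^2,\qquad \mu_K=\frac{\lambda_{\min}(R)\,\lambda_{\min}(X_K)^3}{\lambda_{\max}(X^\star)^2}>0 ,$$ where $\nabla J(K)$ is the gradient of $J$ with respect to $\langle\cdot,\cdot\rangle$, $\|\cdot\|_F$ is the Frobenius norm, and $\lambda_{\min},\lambda_{\max}$ are the smallest and largest eigenvalues of a symmetric matrix. -/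

import Mathlib

open Matrix

namespace LQR

/-- The two time settings, continuous time and discrete time. -/
inductive TimeSetting where
  | ct
  | dt

/-- The data of an LQR problem: system matrices `A`, `B`, performance weights `Q`, `R`, and the
covariance `W` of the initial state. -/
structure Data (n m : ℕ) where
  A : Matrix (Fin n) (Fin n) ℝ
  B : Matrix (Fin n) (Fin m) ℝ
  Q : Matrix (Fin n) (Fin n) ℝ
  R : Matrix (Fin m) (Fin m) ℝ
  W : Matrix (Fin n) (Fin n) ℝ

/-- `M` is a stable matrix: Hurwitz (every complex eigenvalue has negative real part) in continuous
time, Schur (the spectral radius is less than one) in discrete time. -/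
def IsStable {n : ℕ} (τ : TimeSetting) (M : Matrix (Fin n) (Fin n) ℝ) : Prop :=
  match τ with
  | .ct => ∀ z ∈ spectrum ℂ (M.map (algebraMap ℝ ℂ)), z.re < 0
  | .dt => spectralRadius ℂ (M.map (algebraMap ℝ ℂ)) < 1

/-- `(A, B)` is stabilizable: some state feedback makes the closed loop stable. -/
def IsStabilizable {n m : ℕ} (τ : TimeSetting) (A : Matrix (Fin n) (Fin n) ℝ)
    (B : Matrix (Fin n) (Fin m) ℝ) : Prop :=
  ∃ K : Matrix (Fin m) (Fin n) ℝ, IsStable τ (A + B * K)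

/-- `(C, A)` is detectable: some output injection makes the matrix stable. -/
def IsDetectable {n p : ℕ} (τ : TimeSetting) (C : Matrix (Fin p) (Fin n) ℝ)
    (A : Matrix (Fin n) (Fin n) ℝ) : Prop :=
  ∃ L : Matrix (Fin n) (Fin p) ℝ, IsStable τ (A + L * C)

section
open scoped MatrixOrder

/-- The positive semidefinite square root of a positive semidefinite matrix. -/
noncomputable def psdSqrt {n : ℕ} (M : Matrix (Fin n) (Fin n) ℝ) : Matrix (Fin n) (Fin n) ℝ :=
  CFC.sqrt M

end

/-- The operators on symmetric block matrices `[F, G; Gᵀ, H]`: the value is `G + Gᵀ` in continuous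
time and `F - H` in discrete time. -/
def Psi {n : ℕ} (τ : TimeSetting) (M : Matrix (Fin n ⊕ Fin n) (Fin n ⊕ Fin n) ℝ) :
    Matrix (Fin n) (Fin n) ℝ :=
  match τ with
  | .ct => M.toBlocks₁₂ + M.toBlocks₁₂ᵀ
  | .dt => M.toBlocks₁₁ - M.toBlocks₂₂

/-- The smallest eigenvalue of a real symmetric matrix of positive size. -/
noncomputable def lamMin {k : ℕ} (M : Matrix (Fin k) (Fin k) ℝ) : ℝ := sInf (spectrum ℝ M)

/-- The largest eigenvalue of a real symmetric matrix of positive size. -/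
noncomputable def lamMax {k : ℕ} (M : Matrix (Fin k) (Fin k) ℝ) : ℝ := sSup (spectrum ℝ M)

namespace Data

variable {n m : ℕ}

/-- The set of stabilizing gains. -/
def stabilizing (D : Data n m) (τ : TimeSetting) : Set (Matrix (Fin m) (Fin n) ℝ) :=
  {K | IsStable τ (D.A + D.B * K)}

/-- The symmetric matrix `X` solves the Lyapunov equation
`Ψ ([A + BK; I] X [A + BK; I]ᵀ) + W = 0` of the gain `K`. -/
def IsLyapunovSolution (D : Data n m) (τ : TimeSetting) (K : Matrix (Fin m) (Fin n) ℝ)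
    (X : Matrix (Fin n) (Fin n) ℝ) : Prop :=
  X.IsSymm ∧
    Psi τ (fromRows (D.A + D.B * K) 1 * X * (fromRows (D.A + D.B * K) 1)ᵀ) + D.W = 0

open Classical in
/-- The solution `X_K` of the Lyapunov equation of the gain `K`
(zero, by convention, if there is none; used for stabilizing `K` only). -/
noncomputable def lyap (D : Data n m) (τ : TimeSetting) (K : Matrix (Fin m) (Fin n) ℝ) :
    Matrix (Fin n) (Fin n) ℝ :=
  if h : ∃ X, D.IsLyapunovSolution τ K X then h.choose else 0

/-- The LQR cost `J(K) = ⟨Q + Kᵀ R K, X_K⟩`, with `⟨M, N⟩ = Tr (Mᵀ N)`. -/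
noncomputable def cost (D : Data n m) (τ : TimeSetting) (K : Matrix (Fin m) (Fin n) ℝ) : ℝ :=
  trace ((D.Q + Kᵀ * D.R * K)ᵀ * D.lyap τ K)

/-- The optimal value of the cost over the stabilizing gains. -/
noncomputable def optCost (D : Data n m) (τ : TimeSetting) : ℝ :=
  sInf (D.cost τ '' D.stabilizing τ)

/-- `K` is an optimal gain: it minimizes the cost over the stabilizing gains. -/
def IsOptimalGain (D : Data n m) (τ : TimeSetting) (K : Matrix (Fin m) (Fin n) ℝ) : Prop :=
  K ∈ D.stabilizing τ ∧ IsMinOn (D.cost τ) (D.stabilizing τ) K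

/-- The standing assumption on weights, covariance, stabilizability and detectability. -/
structure StandingAssumption (D : Data n m) (τ : TimeSetting) : Prop where
  posSemidef_Q : D.Q.PosSemidef
  Q_ne_zero : D.Q ≠ 0
  posDef_R : D.R.PosDef
  posSemidef_W : D.W.PosSemidef
  W_ne_zero : D.W ≠ 0
  stabilizable : IsStabilizable τ D.A D.B
  detectable : IsDetectable τ (psdSqrt D.Q) D.A

/-- For every gain `K` and every solution `X` of its Lyapunov equation, `K` is stabilizing if and
only if `X` is positive definite. -/
def PosDefAssumption (D : Data n m) (τ : TimeSetting) : Prop :=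
  ∀ (K : Matrix (Fin m) (Fin n) ℝ) (X : Matrix (Fin n) (Fin n) ℝ),
    D.IsLyapunovSolution τ K X → (K ∈ D.stabilizing τ ↔ X.PosDef)

/-- The constant `μ_K = λ_min(R) λ_min(X_K)³ / λ_max(X⋆)²`, with `X⋆` the Lyapunov solution of the
gain `Kstar`. -/
noncomputable def dominanceConst (D : Data n m) (τ : TimeSetting)
    (Kstar K : Matrix (Fin m) (Fin n) ℝ) : ℝ :=
  lamMin D.R * lamMin (D.lyap τ K) ^ 3 / lamMax (D.lyap τ Kstar) ^ 2

end Data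

/-- The Frobenius norm `√⟨M, M⟩`, where `⟨M, N⟩ = Tr (Mᵀ N)`. -/
noncomputable def frobNorm {n m : ℕ} (M : Matrix (Fin m) (Fin n) ℝ) : ℝ :=
  Real.sqrt (trace (Mᵀ * M))

/-- The gradient of a real function of a real matrix with respect to the inner product
`⟨M, N⟩ = Tr (Mᵀ N)`: its entries are the partial derivatives. -/
noncomputable def matGradient {n m : ℕ} (f : Matrix (Fin m) (Fin n) ℝ → ℝ)
    (K : Matrix (Fin m) (Fin n) ℝ) : Matrix (Fin m) (Fin n) ℝ :=
  Matrix.of fun i j => fderiv ℝ f K (Matrix.single i j 1)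

end LQR

/-! Everything rests on an exact formula for cost differences, `cost_eq_cost_add`. For a stabilizing
gain `K` let `P` solve the adjoint Lyapunov equation with weight `Q + Kᵀ R K`. Duality of the two
Lyapunov operators gives, with `Δ = K' - K`, `E` the `gradFactor` and `S` the `curvature`, `J(K') -
J(K) = 2 ⟨E, Δ X_{K'}⟩ + ⟨Δᵀ S Δ, X_{K'}⟩`, where `S ⪰ R`.

It is used in three ways. As `K' → K`, continuity of `X_K` alone yields `∇J(K) = 2 E X_K`, whence
`‖∇J(K)‖² ≥ 4 λ_min(X_K)² ‖E‖²`. At `K' = K⋆` the last term is nonnegative, so by Cauchy-Schwarz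
`J(K) - J⋆ ≤ 2 ‖E‖ ‖K - K⋆‖ λ_max(X⋆)`. Based at `K⋆`, where `E = 0`, it gives `J(K) - J⋆ ≥ λ_min(R)
λ_min(X_K) ‖K - K⋆‖²`, which also proves that `K⋆` is the unique minimizer. Eliminating `‖E‖` and
`‖K - K⋆‖` leaves `μ_K`.

A gain with `E = 0` comes from a Riccati solution (`exists_riccati`), obtained by minimizing the
trace over a compact set of solutions of the Riccati inequality; detectability makes the greedy gain
of such a solution stabilizing. -/

namespace LQR

open Filter Topology

variable {n m : ℕ}

/-! ### Spectra, powers, and reduction of continuous to discrete time -/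

/-- The Lyapunov operator `X ↦ M X + X Mᵀ` in continuous time and `X ↦ M X Mᵀ - X` in discrete
time. -/
def lyapOp (τ : TimeSetting) (M X : Matrix (Fin n) (Fin n) ℝ) : Matrix (Fin n) (Fin n) ℝ :=
  match τ with
  | .ct => M * X + X * Mᵀ
  | .dt => M * X * Mᵀ - X

theorem mem_spectrum_iff_exists_mulVec {A : Matrix (Fin n) (Fin n) ℂ} {z : ℂ} :
    z ∈ spectrum ℂ A ↔ ∃ v ≠ 0, A *ᵥ v = z • v := by
  rw [spectrum.mem_iff, Matrix.isUnit_iff_isUnit_det, isUnit_iff_ne_zero, not_not,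
    ← Matrix.exists_mulVec_eq_zero_iff]
  refine exists_congr fun v => and_congr_right fun _ => ?_
  rw [Matrix.sub_mulVec, sub_eq_zero, Algebra.algebraMap_eq_smul_one, Matrix.smul_mulVec,
    Matrix.one_mulVec, eq_comm]

/-- Real and imaginary parts of a complex eigenvector `x + iy`; later arguments then use only real
quadratic forms. -/
theorem mem_spectrum_map_iff {M : Matrix (Fin n) (Fin n) ℝ} {z : ℂ} :
    z ∈ spectrum ℂ (M.map (algebraMap ℝ ℂ)) ↔
      ∃ x y : Fin n → ℝ, (x ≠ 0 ∨ y ≠ 0) ∧ M *ᵥ x = z.re • x - z.im • y ∧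
        M *ᵥ y = z.im • x + z.re • y := by
  rw [mem_spectrum_iff_exists_mulVec]
  constructor
  · rintro ⟨v, hv, h⟩
    refine ⟨fun i => (v i).re, fun i => (v i).im, ?_, ?_, ?_⟩
    · by_contra! hc
      exact hv (funext fun i => Complex.ext (congrFun hc.1 i) (congrFun hc.2 i))
    · ext i
      simpa [Matrix.mulVec, dotProduct] using congrArg Complex.re (congrFun h i)
    · ext i
      have := congrArg Complex.im (congrFun h i)
      simp [Matrix.mulVec, dotProduct] at this ⊢
      linarith
  · rintro ⟨x, y, hxy, hx, hy⟩
    refine ⟨fun i => ⟨x i, y i⟩, ?_, ?_⟩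
    · intro h
      rcases hxy with hxy | hxy
      · exact hxy (funext fun i => congrArg Complex.re (congrFun h i))
      · exact hxy (funext fun i => congrArg Complex.im (congrFun h i))
    · ext i
      refine Complex.ext ?_ ?_
      · simpa [Matrix.mulVec, dotProduct] using congrFun hx i
      · have := congrFun hy i
        simp [Matrix.mulVec, dotProduct] at this ⊢
        linarith

section Gelfand

attribute [local instance] Matrix.linftyOpNormedRing Matrix.linftyOpNormedAlgebra

theorem spectralRadius_lt_one_iff (hn : 0 < n) {A : Matrix (Fin n) (Fin n) ℂ} :
    spectralRadius ℂ A < 1 ↔ ∀ z ∈ spectrum ℂ A, ‖z‖ < 1 := by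
  have : NeZero n := ⟨hn.ne'⟩
  have : Nonempty (Fin n) := ⟨⟨0, hn⟩⟩
  have : CompleteSpace (Matrix (Fin n) (Fin n) ℂ) := FiniteDimensional.complete ℂ _
  constructor
  · intro h z hz
    have : (‖z‖₊ : ENNReal) < 1 :=
      lt_of_le_of_lt (le_iSup₂ (f := fun k _ => (‖k‖₊ : ENNReal)) z hz) h
    exact_mod_cast this
  · intro h
    exact_mod_cast spectrum.spectralRadius_lt_of_forall_lt A (r := 1) fun z hz => by
      exact_mod_cast h z hz

/-- Gelfand's formula: for `r` strictly between the spectral radius and `1`, eventually `‖A ^ k‖ < r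
^ k`. -/
theorem tendsto_pow_of_spectralRadius_lt_one {A : Matrix (Fin n) (Fin n) ℂ}
    (h : spectralRadius ℂ A < 1) : Tendsto (fun k => A ^ k) atTop (𝓝 0) := by
  have : CompleteSpace (Matrix (Fin n) (Fin n) ℂ) := FiniteDimensional.complete ℂ _
  obtain ⟨r, hr, hr1⟩ := exists_between h
  have hr' : r ≠ ⊤ := ne_top_of_lt hr1
  lift r to NNReal using hr'
  have hev := (spectrum.pow_nnnorm_pow_one_div_tendsto_nhds_spectralRadius A).eventually_lt_const hr
  have hr1' : (r : ℝ) < 1 := by exact_mod_cast hr1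
  refine tendsto_zero_iff_norm_tendsto_zero.2 ?_
  refine squeeze_zero' (Eventually.of_forall fun k => norm_nonneg _) ?_
    (tendsto_pow_atTop_nhds_zero_of_lt_one r.2 hr1')
  filter_upwards [hev, eventually_gt_atTop 0] with k hk hk0
  have hk0' : (0 : ℝ) < k := by exact_mod_cast hk0
  have h1 := ENNReal.rpow_le_rpow hk.le hk0'.le
  rw [← ENNReal.rpow_mul, one_div, inv_mul_cancel₀ hk0'.ne', ENNReal.rpow_one,
    ENNReal.rpow_natCast] at h1
  exact_mod_cast h1

end Gelfand

theorem tendsto_pow_of_map {M : Matrix (Fin n) (Fin n) ℝ}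
    (h : spectralRadius ℂ (M.map (algebraMap ℝ ℂ)) < 1) :
    Tendsto (fun k => M ^ k) atTop (𝓝 0) := by
  have h1 := tendsto_pow_of_spectralRadius_lt_one h
  have hc : Continuous fun B : Matrix (Fin n) (Fin n) ℂ => B.map Complex.re :=
    continuous_id.matrix_map Complex.continuous_re
  have h2 := (hc.tendsto 0).comp h1
  refine (h2.congr fun k => ?_).trans_eq ?_
  · have : M.map (algebraMap ℝ ℂ) ^ k = (M ^ k).map (algebraMap ℝ ℂ) :=
      (map_pow (algebraMap ℝ ℂ).mapMatrix M k).symm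
    change (M.map (algebraMap ℝ ℂ) ^ k).map Complex.re = M ^ k
    rw [this]
    ext i j
    simp
  · congr 1

theorem IsStable.transpose {τ : TimeSetting} {M : Matrix (Fin n) (Fin n) ℝ} (h : IsStable τ M) :
    IsStable τ Mᵀ := by
  have hs : spectrum ℂ (Mᵀ.map (algebraMap ℝ ℂ)) = spectrum ℂ (M.map (algebraMap ℝ ℂ)) := by
    ext z
    rw [spectrum.mem_iff, spectrum.mem_iff, ← Matrix.isUnit_transpose]
    simp [Matrix.transpose_map, Algebra.algebraMap_eq_smul_one]
  cases τ
  · simpa only [IsStable, hs] using h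
  · simpa only [IsStable, spectralRadius, hs] using h

/-- In discrete time `N = M`. In continuous time `N` is the Cayley transform `(1 - M)⁻¹ (1 + M)`,
which carries the left half plane to the unit disc. Lyapunov facts then need only one proof, from `N
^ k → 0`. -/
theorem IsStable.exists_discretization {τ : TimeSetting} {M : Matrix (Fin n) (Fin n) ℝ}
    (hn : 0 < n) (h : IsStable τ M) :
    ∃ (N U : Matrix (Fin n) (Fin n) ℝ) (c : ℝ), 0 < c ∧
      Tendsto (fun k => N ^ k) atTop (𝓝 0) ∧
      ∀ X, N * X * Nᵀ - X = c • (U * lyapOp τ M X * Uᵀ) := by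
  cases τ with
  | dt =>
    exact ⟨M, 1, 1, one_pos, tendsto_pow_of_map h, fun X => by simp [lyapOp]⟩
  | ct =>
    have hu : IsUnit (1 - M).det := by
      rw [isUnit_iff_ne_zero]
      intro h0
      obtain ⟨v, hv, hv0⟩ := Matrix.exists_mulVec_eq_zero_iff.2 h0
      have : (1 : ℂ) ∈ spectrum ℂ (M.map (algebraMap ℝ ℂ)) := by
        rw [mem_spectrum_map_iff]
        refine ⟨v, 0, Or.inl hv, ?_, by simp⟩
        rw [Matrix.sub_mulVec, Matrix.one_mulVec, sub_eq_zero] at hv0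
        simp [← hv0]
      have := h _ this
      norm_num at this
    have hmul : (1 - M) * ((1 - M)⁻¹ * (1 + M)) = 1 + M := by
      rw [← Matrix.mul_assoc, Matrix.mul_nonsing_inv _ hu, Matrix.one_mul]
    refine ⟨(1 - M)⁻¹ * (1 + M), (1 - M)⁻¹, 2, two_pos, ?_, fun X => ?_⟩
    · apply tendsto_pow_of_map
      rw [spectralRadius_lt_one_iff hn]
      intro z hz
      obtain ⟨v, hv, hvz⟩ := mem_spectrum_iff_exists_mulVec.1 hz
      set f : Matrix (Fin n) (Fin n) ℝ →+* Matrix (Fin n) (Fin n) ℂ :=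
        (algebraMap ℝ ℂ).mapMatrix with hf
      have hvz' : f ((1 - M)⁻¹ * (1 + M)) *ᵥ v = z • v := hvz
      have e1 : (1 + f M) *ᵥ v = (1 - f M) *ᵥ (z • v) := by
        rw [← hvz', Matrix.mulVec_mulVec, ← map_one f, ← map_sub, ← map_mul, hmul, map_add, map_one]
      rw [Matrix.add_mulVec, Matrix.sub_mulVec, Matrix.one_mulVec, Matrix.one_mulVec,
        Matrix.mulVec_smul] at e1
      have e2 : (z + 1) • (f M *ᵥ v) = (z - 1) • v := by
        rw [add_smul, sub_smul, one_smul, one_smul]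
        linear_combination e1
      have hz1 : z + 1 ≠ 0 := by
        intro h0
        rw [h0, zero_smul] at e2
        have h3 : z - 1 ≠ 0 := by
          rw [eq_neg_of_add_eq_zero_left h0]; norm_num
        exact hv ((smul_eq_zero.1 e2.symm).resolve_left h3)
      -- The inverse Cayley transform sends an eigenvalue `z` of `N` to one of `M`; negativity of
      -- its real part says `|z|² - 1 = Re ((z - 1) conj (z + 1)) < 0`.
      have hmem : (z - 1) / (z + 1) ∈ spectrum ℂ (M.map (algebraMap ℝ ℂ)) := by
        rw [mem_spectrum_iff_exists_mulVec]
        refine ⟨v, hv, ?_⟩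
        change f M *ᵥ v = _
        rw [div_eq_inv_mul, mul_smul, ← e2, smul_smul, inv_mul_cancel₀ hz1, one_smul]
      have hre := h _ hmem
      rw [Complex.div_re, ← add_div, div_neg_iff] at hre
      have hpos : 0 < Complex.normSq (z + 1) := Complex.normSq_pos.2 hz1
      have hre' : (z - 1).re * (z + 1).re + (z - 1).im * (z + 1).im < 0 := by
        rcases hre with hre | hre
        · linarith [hre.2]
        · exact hre.1
      simp at hre'
      have hsq : ‖z‖ ^ 2 < 1 := by
        rw [Complex.sq_norm, Complex.normSq_apply]; nlinarith
      nlinarith [norm_nonneg z]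
    · have hX : X = (1 - M)⁻¹ * ((1 - M) * X * (1 - M)ᵀ) * (1 - M)⁻¹ᵀ := by
        have h2 : (1 - M)ᵀ * (1 - M)⁻¹ᵀ = 1 := by
          rw [← Matrix.transpose_mul, Matrix.nonsing_inv_mul _ hu, Matrix.transpose_one]
        calc X = ((1 - M)⁻¹ * (1 - M)) * X * ((1 - M)ᵀ * (1 - M)⁻¹ᵀ) := by
              rw [Matrix.nonsing_inv_mul _ hu, h2, Matrix.one_mul, Matrix.mul_one]
          _ = _ := by simp only [Matrix.mul_assoc]
      conv_lhs => rw [sub_eq_add_neg]; arg 2; rw [hX]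
      generalize (1 - M)⁻¹ = U
      simp only [lyapOp, Matrix.transpose_mul, Matrix.transpose_add, Matrix.transpose_sub,
        Matrix.transpose_one, two_smul]
      noncomm_ring

/-! ### The Lyapunov equation of a stable matrix -/

theorem conj_iterate_eq {N X : Matrix (Fin n) (Fin n) ℝ} (h : N * X * Nᵀ = X) (k : ℕ) :
    N ^ k * X * (N ^ k)ᵀ = X := by
  induction k with
  | zero => simp
  | succ k ih =>
    rw [pow_succ, Matrix.transpose_mul]
    calc N ^ k * N * X * (Nᵀ * (N ^ k)ᵀ) = N ^ k * (N * X * Nᵀ) * (N ^ k)ᵀ := by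
          simp only [Matrix.mul_assoc]
      _ = X := by rw [h, ih]

theorem tendsto_conj_pow {N : Matrix (Fin n) (Fin n) ℝ} (X : Matrix (Fin n) (Fin n) ℝ)
    (h : Tendsto (fun k => N ^ k) atTop (𝓝 0)) :
    Tendsto (fun k => N ^ k * X * (N ^ k)ᵀ) atTop (𝓝 0) := by
  have hc : Continuous fun Y : Matrix (Fin n) (Fin n) ℝ => Y * X * Yᵀ := by fun_prop
  have h1 := (hc.tendsto 0).comp h
  rwa [Matrix.mul_assoc, Matrix.zero_mul] at h1

theorem IsStable.eq_zero_of_lyapOp_eq_zero {τ : TimeSetting} {M X : Matrix (Fin n) (Fin n) ℝ}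
    (hn : 0 < n) (h : IsStable τ M) (hX : lyapOp τ M X = 0) : X = 0 := by
  obtain ⟨N, U, c, -, hN, hNU⟩ := h.exists_discretization hn
  have h1 : N * X * Nᵀ = X := sub_eq_zero.1 (by rw [hNU, hX]; simp)
  refine tendsto_nhds_unique ?_ (tendsto_conj_pow X hN)
  simp only [conj_iterate_eq h1]
  exact tendsto_const_nhds

theorem posSemidef_iff_isSymm {M : Matrix (Fin n) (Fin n) ℝ} :
    M.PosSemidef ↔ M.IsSymm ∧ ∀ x, 0 ≤ x ⬝ᵥ M *ᵥ x := by
  rw [Matrix.posSemidef_iff_dotProduct_mulVec]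
  simp [Matrix.IsHermitian, Matrix.IsSymm, Matrix.conjTranspose_eq_transpose_of_trivial]

theorem _root_.Matrix.PosSemidef.isSymm {M : Matrix (Fin n) (Fin n) ℝ} (h : M.PosSemidef) :
    M.IsSymm := (posSemidef_iff_isSymm.1 h).1

theorem _root_.Matrix.PosSemidef.quad_nonneg {M : Matrix (Fin n) (Fin n) ℝ} (h : M.PosSemidef)
    (x : Fin n → ℝ) : 0 ≤ x ⬝ᵥ M *ᵥ x := (posSemidef_iff_isSymm.1 h).2 x

theorem _root_.Matrix.PosSemidef.conj {k : ℕ} {M : Matrix (Fin n) (Fin n) ℝ} (h : M.PosSemidef)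
    (U : Matrix (Fin k) (Fin n) ℝ) : (U * M * Uᵀ).PosSemidef := by
  simpa [Matrix.conjTranspose_eq_transpose_of_trivial] using h.mul_mul_conjTranspose_same U

theorem _root_.Matrix.PosSemidef.conj' {k : ℕ} {M : Matrix (Fin n) (Fin n) ℝ} (h : M.PosSemidef)
    (U : Matrix (Fin n) (Fin k) ℝ) : (Uᵀ * M * U).PosSemidef := by
  simpa using h.conj Uᵀ

/-- `X - N ^ k X (N ^ k)ᵀ` telescopes into a sum of positive semidefinite terms and converges to
`X`. -/
theorem IsStable.posSemidef {τ : TimeSetting} {M X : Matrix (Fin n) (Fin n) ℝ}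
    (hn : 0 < n) (h : IsStable τ M) (hX : X.IsSymm) (hS : (-lyapOp τ M X).PosSemidef) :
    X.PosSemidef := by
  obtain ⟨N, U, c, hc, hN, hNU⟩ := h.exists_discretization hn
  have h1 : (X - N * X * Nᵀ).PosSemidef := by
    have : X - N * X * Nᵀ = c • (U * -lyapOp τ M X * Uᵀ) := by
      rw [← neg_sub, hNU]; simp
    rw [this]
    exact (hS.conj U).smul hc.le
  have h2 (k : ℕ) : (X - N ^ k * X * (N ^ k)ᵀ).PosSemidef := by
    induction k with
    | zero => simpa using Matrix.PosSemidef.zero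
    | succ k ih =>
      have : X - N ^ (k + 1) * X * (N ^ (k + 1))ᵀ =
          (X - N ^ k * X * (N ^ k)ᵀ) + N ^ k * (X - N * X * Nᵀ) * (N ^ k)ᵀ := by
        rw [pow_succ, Matrix.transpose_mul]
        noncomm_ring
      rw [this]
      exact ih.add (h1.conj _)
  refine posSemidef_iff_isSymm.2 ⟨hX, fun x => ?_⟩
  have hcont : Continuous fun Y : Matrix (Fin n) (Fin n) ℝ => x ⬝ᵥ (X - Y) *ᵥ x := by fun_prop
  have h3 := (hcont.tendsto 0).comp (tendsto_conj_pow X hN)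
  simp only [sub_zero] at h3
  exact ge_of_tendsto' h3 fun k => (h2 k).quad_nonneg x

/-- The Lyapunov operator as a linear map. -/
def lyapLin (τ : TimeSetting) (M : Matrix (Fin n) (Fin n) ℝ) :
    Matrix (Fin n) (Fin n) ℝ →ₗ[ℝ] Matrix (Fin n) (Fin n) ℝ where
  toFun := lyapOp τ M
  map_add' X Y := by cases τ <;> simp only [lyapOp] <;> noncomm_ring
  map_smul' c X := by cases τ <;> simp [lyapOp, smul_sub]

theorem lyapOp_sub (τ : TimeSetting) (M X Y : Matrix (Fin n) (Fin n) ℝ) :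
    lyapOp τ M (X - Y) = lyapOp τ M X - lyapOp τ M Y := (lyapLin τ M).map_sub X Y

theorem lyapOp_transpose (τ : TimeSetting) (M X : Matrix (Fin n) (Fin n) ℝ) :
    (lyapOp τ M X)ᵀ = lyapOp τ M Xᵀ := by
  cases τ <;> simp [lyapOp, Matrix.mul_assoc, add_comm]

theorem isSymm_of_lyapOp_isSymm {τ : TimeSetting} {M X : Matrix (Fin n) (Fin n) ℝ}
    (hinj : ∀ Y, lyapOp τ M Y = 0 → Y = 0) (h : (lyapOp τ M X).IsSymm) : X.IsSymm := by
  refine sub_eq_zero.1 (hinj _ ?_)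
  rw [lyapOp_sub, ← lyapOp_transpose, h.eq, sub_self]

theorem IsStable.exists_lyapOp_eq {τ : TimeSetting} {M : Matrix (Fin n) (Fin n) ℝ}
    (hn : 0 < n) (h : IsStable τ M) (C : Matrix (Fin n) (Fin n) ℝ) :
    ∃ X, lyapOp τ M X = C := by
  have hinj : Function.Injective (lyapLin τ M) :=
    (injective_iff_map_eq_zero _).2 fun X hX => h.eq_zero_of_lyapOp_eq_zero hn hX
  exact LinearMap.surjective_of_injective hinj C

/-! ### Stability from a Lyapunov inequality and detectability -/

theorem isStable_iff (hn : 0 < n) {τ : TimeSetting} {M : Matrix (Fin n) (Fin n) ℝ} :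
    IsStable τ M ↔ ∀ z ∈ spectrum ℂ (M.map (algebraMap ℝ ℂ)),
      match τ with
      | .ct => z.re < 0
      | .dt => ‖z‖ < 1 := by
  cases τ
  · rfl
  · exact spectralRadius_lt_one_iff hn

theorem _root_.Matrix.PosSemidef.mulVec_psdSqrt_eq_zero {Q : Matrix (Fin n) (Fin n) ℝ}
    (hQ : Q.PosSemidef) {x : Fin n → ℝ} (h : x ⬝ᵥ Q *ᵥ x = 0) : psdSqrt Q *ᵥ x = 0 := by
  open scoped MatrixOrder in
  have hs : psdSqrt Q * psdSqrt Q = Q := CFC.sqrt_mul_sqrt_self Q hQ.nonneg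
  have hsym : (psdSqrt Q).PosSemidef := by
    open scoped MatrixOrder in
    exact Matrix.nonneg_iff_posSemidef.1 (CFC.sqrt_nonneg Q)
  rw [← hs, ← Matrix.mulVec_mulVec, Matrix.dotProduct_mulVec, ← Matrix.mulVec_transpose,
    hsym.isSymm.eq] at h
  exact dotProduct_self_eq_zero.1 h

theorem _root_.Matrix.PosDef.quad_pos {M : Matrix (Fin n) (Fin n) ℝ} (h : M.PosDef)
    {x : Fin n → ℝ} (hx : x ≠ 0) : 0 < x ⬝ᵥ M *ᵥ x := by
  simpa using h.dotProduct_mulVec_pos hx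

theorem dotProduct_mulVec_congr (M P : Matrix (Fin n) (Fin n) ℝ) (x y : Fin n → ℝ) :
    x ⬝ᵥ (Mᵀ * P) *ᵥ y = (M *ᵥ x) ⬝ᵥ P *ᵥ y := by
  rw [← Matrix.mulVec_mulVec, Matrix.dotProduct_mulVec, Matrix.vecMul_transpose]

theorem lyapOp_transpose_ct_quad {M P : Matrix (Fin n) (Fin n) ℝ} (hP : P.IsSymm)
    (x : Fin n → ℝ) :
    x ⬝ᵥ lyapOp .ct Mᵀ P *ᵥ x = 2 * ((M *ᵥ x) ⬝ᵥ P *ᵥ x) := by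
  have h : x ⬝ᵥ (P * M) *ᵥ x = (M *ᵥ x) ⬝ᵥ P *ᵥ x := by
    rw [← Matrix.mulVec_mulVec, Matrix.dotProduct_mulVec, ← Matrix.mulVec_transpose, hP.eq,
      dotProduct_comm]
  simp only [lyapOp, Matrix.transpose_transpose, Matrix.add_mulVec, dotProduct_add]
  rw [h, dotProduct_mulVec_congr]; ring

theorem lyapOp_transpose_dt_quad {M P : Matrix (Fin n) (Fin n) ℝ} (x : Fin n → ℝ) :
    x ⬝ᵥ lyapOp .dt Mᵀ P *ᵥ x = (M *ᵥ x) ⬝ᵥ P *ᵥ (M *ᵥ x) - x ⬝ᵥ P *ᵥ x := by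
  simp only [lyapOp, Matrix.transpose_transpose, Matrix.sub_mulVec, dotProduct_sub]
  rw [← Matrix.mulVec_mulVec, dotProduct_mulVec_congr]

theorem _root_.Matrix.IsSymm.dotProduct_mulVec_comm {P : Matrix (Fin n) (Fin n) ℝ} (hP : P.IsSymm)
    (x y : Fin n → ℝ) : y ⬝ᵥ P *ᵥ x = x ⬝ᵥ P *ᵥ y := by
  rw [Matrix.dotProduct_mulVec, ← Matrix.mulVec_transpose, hP.eq, dotProduct_comm]

namespace Data

/-- The left-hand side of the closed-loop Lyapunov equation of the cost matrix `P`. -/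
def costResidual (D : Data n m) (τ : TimeSetting) (K : Matrix (Fin m) (Fin n) ℝ)
    (P : Matrix (Fin n) (Fin n) ℝ) : Matrix (Fin n) (Fin n) ℝ :=
  lyapOp τ (D.A + D.B * K)ᵀ P + (D.Q + Kᵀ * D.R * K)

/-- The factor `E` of the gradient `2 E X` of the cost. -/
def gradFactor (D : Data n m) (τ : TimeSetting) (K : Matrix (Fin m) (Fin n) ℝ)
    (P : Matrix (Fin n) (Fin n) ℝ) : Matrix (Fin m) (Fin n) ℝ :=
  match τ with
  | .ct => D.R * K + D.Bᵀ * P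
  | .dt => D.R * K + D.Bᵀ * P * (D.A + D.B * K)

/-- The quadratic coefficient of `costResidual` as a function of the gain. -/
def curvature (D : Data n m) (τ : TimeSetting) (P : Matrix (Fin n) (Fin n) ℝ) :
    Matrix (Fin m) (Fin m) ℝ :=
  match τ with
  | .ct => D.R
  | .dt => D.R + D.Bᵀ * P * D.B

theorem costResidual_add {D : Data n m} (hR : D.R.IsSymm) (τ : TimeSetting)
    (K Δ : Matrix (Fin m) (Fin n) ℝ) {P : Matrix (Fin n) (Fin n) ℝ} (hP : P.IsSymm) :
    D.costResidual τ (K + Δ) P = D.costResidual τ K P + Δᵀ * D.gradFactor τ K P +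
      (D.gradFactor τ K P)ᵀ * Δ + Δᵀ * D.curvature τ P * Δ := by
  cases τ <;>
  · simp only [costResidual, gradFactor, curvature, lyapOp, Matrix.transpose_add,
      Matrix.transpose_mul, Matrix.transpose_transpose, Matrix.mul_add, Matrix.add_mul, hP.eq,
      hR.eq, Matrix.mul_assoc]
    abel

theorem posDef_curvature {D : Data n m} (hR : D.R.PosDef) (τ : TimeSetting)
    {P : Matrix (Fin n) (Fin n) ℝ} (hP : P.PosSemidef) : (D.curvature τ P).PosDef := by
  cases τ
  · exact hR
  · exact hR.add_posSemidef (hP.conj' _)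

theorem posSemidef_curvature_sub {D : Data n m} (τ : TimeSetting)
    {P : Matrix (Fin n) (Fin n) ℝ} (hP : P.PosSemidef) : (D.curvature τ P - D.R).PosSemidef := by
  cases τ
  · simpa [curvature] using Matrix.PosSemidef.zero
  · simpa [curvature] using hP.conj' D.B

/-- At an unstable closed-loop mode `v = x + iy` the Lyapunov term is a nonnegative multiple of `v*
P v`: the factor is `2 Re z` or `|z|² - 1`. The inequality then forces `Q^{1/2} v = 0` and `K v =
0`, so every output injection keeps the mode `v`, against detectability. -/
theorem mem_stabilizing_of_costResidual {D : Data n m} {τ : TimeSetting} (hn : 0 < n)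
    (h1 : D.StandingAssumption τ) {K : Matrix (Fin m) (Fin n) ℝ} {P : Matrix (Fin n) (Fin n) ℝ}
    (hP : P.PosSemidef) (hS : (-D.costResidual τ K P).PosSemidef) : K ∈ D.stabilizing τ := by
  obtain ⟨L, hL⟩ := h1.detectable
  change IsStable τ (D.A + D.B * K)
  rw [isStable_iff hn] at hL ⊢
  intro z hz
  obtain ⟨x, y, hxy, hx, hy⟩ := mem_spectrum_map_iff.1 hz
  have hRK (v : Fin n → ℝ) : v ⬝ᵥ (Kᵀ * D.R * K) *ᵥ v = (K *ᵥ v) ⬝ᵥ D.R *ᵥ (K *ᵥ v) := by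
    rw [Matrix.mul_assoc, ← Matrix.mulVec_mulVec, Matrix.dotProduct_mulVec,
      Matrix.vecMul_transpose, ← Matrix.mulVec_mulVec]
  have hquad (v : Fin n → ℝ) : v ⬝ᵥ lyapOp τ (D.A + D.B * K)ᵀ P *ᵥ v + v ⬝ᵥ D.Q *ᵥ v +
      (K *ᵥ v) ⬝ᵥ D.R *ᵥ (K *ᵥ v) ≤ 0 := by
    have := hS.quad_nonneg v
    simp only [costResidual, Matrix.neg_mulVec, Matrix.add_mulVec, dotProduct_neg,
      dotProduct_add, hRK] at this
    linarith
  have key (hL0 : 0 ≤ x ⬝ᵥ lyapOp τ (D.A + D.B * K)ᵀ P *ᵥ x +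
      y ⬝ᵥ lyapOp τ (D.A + D.B * K)ᵀ P *ᵥ y) :
      z ∈ spectrum ℂ ((D.A + L * psdSqrt D.Q).map (algebraMap ℝ ℂ)) := by
    have hqx := h1.posSemidef_Q.quad_nonneg x
    have hqy := h1.posSemidef_Q.quad_nonneg y
    have hrx := h1.posDef_R.posSemidef.quad_nonneg (K *ᵥ x)
    have hry := h1.posDef_R.posSemidef.quad_nonneg (K *ᵥ y)
    have hx0 := hquad x
    have hy0 := hquad y
    have hQx := h1.posSemidef_Q.mulVec_psdSqrt_eq_zero (x := x) (by linarith)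
    have hQy := h1.posSemidef_Q.mulVec_psdSqrt_eq_zero (x := y) (by linarith)
    have hKx : K *ᵥ x = 0 := by
      by_contra hne
      have := h1.posDef_R.quad_pos hne
      linarith
    have hKy : K *ᵥ y = 0 := by
      by_contra hne
      have := h1.posDef_R.quad_pos hne
      linarith
    refine mem_spectrum_map_iff.2 ⟨x, y, hxy, ?_, ?_⟩
    · rw [← hx, Matrix.add_mulVec, Matrix.add_mulVec, ← Matrix.mulVec_mulVec,
        ← Matrix.mulVec_mulVec, hQx, hKx, Matrix.mulVec_zero, Matrix.mulVec_zero]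
    · rw [← hy, Matrix.add_mulVec, Matrix.add_mulVec, ← Matrix.mulVec_mulVec,
        ← Matrix.mulVec_mulVec, hQy, hKy, Matrix.mulVec_zero, Matrix.mulVec_zero]
  have hpx := hP.quad_nonneg x
  have hpy := hP.quad_nonneg y
  have hc := hP.isSymm.dotProduct_mulVec_comm x y
  cases τ with
  | ct =>
    by_contra! hre
    refine absurd (hL z (key ?_)) (not_lt.2 hre)
    rw [lyapOp_transpose_ct_quad hP.isSymm, lyapOp_transpose_ct_quad hP.isSymm, hx, hy]
    simp only [sub_dotProduct, add_dotProduct, smul_dotProduct, smul_eq_mul, hc]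
    have := mul_nonneg hre (add_nonneg hpx hpy)
    linarith
  | dt =>
    by_contra! hre
    refine absurd (hL z (key ?_)) (not_lt.2 hre)
    rw [lyapOp_transpose_dt_quad, lyapOp_transpose_dt_quad, hx, hy]
    simp only [sub_dotProduct, add_dotProduct, smul_dotProduct, smul_eq_mul, Matrix.mulVec_add,
      Matrix.mulVec_sub, Matrix.mulVec_smul, dotProduct_add, dotProduct_sub, dotProduct_smul, hc]
    have h2 : 1 ≤ z.re * z.re + z.im * z.im := by
      rw [← Complex.normSq_apply, ← Complex.sq_norm]
      nlinarith
    have := mul_nonneg (sub_nonneg.2 h2) (add_nonneg hpx hpy)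
    linarith

end Data

/-! ### A stabilizing Riccati solution by compactness -/

theorem isClosed_setOf_posSemidef :
    IsClosed {P : Matrix (Fin n) (Fin n) ℝ | P.PosSemidef} := by
  simp only [posSemidef_iff_isSymm, Set.ofPred_and, Set.ofPred_forall]
  refine IsClosed.inter ?_ (isClosed_iInter fun x => ?_)
  · exact isClosed_eq (by fun_prop) continuous_id
  · exact isClosed_le continuous_const (by fun_prop)

/-- Testing the form on `e_i ± e_j` gives `2 |P i j| ≤ P i i + P j j`. This bounds the positive
semidefinite matrices of bounded trace. -/
theorem _root_.Matrix.PosSemidef.abs_apply_le_trace {P : Matrix (Fin n) (Fin n) ℝ}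
    (hP : P.PosSemidef) (i j : Fin n) : |P i j| ≤ P.trace := by
  have hd (k : Fin n) : P k k ≤ P.trace :=
    Finset.single_le_sum (f := fun k => P k k) (fun l _ => hP.diag_nonneg) (Finset.mem_univ k)
  have h1 := hP.quad_nonneg (Pi.single i 1 + Pi.single j 1)
  have h2 := hP.quad_nonneg (Pi.single i 1 - Pi.single j 1)
  have hs : P j i = P i j := hP.isSymm.apply i j
  simp only [Matrix.mulVec_add, Matrix.mulVec_sub, add_dotProduct, sub_dotProduct,
    dotProduct_add, dotProduct_sub, Matrix.mulVec_single_one, single_one_dotProduct,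
    Matrix.col_apply, hs] at h1 h2
  have := hd i
  have := hd j
  rw [abs_le]
  constructor <;> linarith

theorem isCompact_posSemidef_trace_le (c : ℝ) :
    IsCompact {P : Matrix (Fin n) (Fin n) ℝ | P.PosSemidef ∧ P.trace ≤ c} := by
  have hK : IsCompact (Set.univ.pi fun _ : Fin n => Set.univ.pi fun _ : Fin n => Set.Icc (-c) c) :=
    isCompact_univ_pi fun _ => isCompact_univ_pi fun _ => isCompact_Icc
  refine IsCompact.of_isClosed_subset (X := Matrix (Fin n) (Fin n) ℝ) hK ?_ ?_
  · exact isClosed_setOf_posSemidef.inter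
      (isClosed_le (continuous_id.matrix_trace) continuous_const)
  · intro P hP i _ j _
    exact abs_le.1 ((hP.1.abs_apply_le_trace i j).trans hP.2)

theorem continuous_lyapOp {α : Type*} [TopologicalSpace α] (τ : TimeSetting)
    {M X : α → Matrix (Fin n) (Fin n) ℝ} (hM : Continuous M) (hX : Continuous X) :
    Continuous fun a => lyapOp τ (M a) (X a) := by
  cases τ <;> simp only [lyapOp] <;> fun_prop

namespace Data

/-- The value at `0` of `gradFactor` as an affine function of the gain. -/
def gradOffset (D : Data n m) (τ : TimeSetting) (P : Matrix (Fin n) (Fin n) ℝ) :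
    Matrix (Fin m) (Fin n) ℝ :=
  match τ with
  | .ct => D.Bᵀ * P
  | .dt => D.Bᵀ * P * D.A

/-- The greedy gain for the cost matrix `P`. -/
noncomputable def greedyGain (D : Data n m) (τ : TimeSetting) (P : Matrix (Fin n) (Fin n) ℝ) :
    Matrix (Fin m) (Fin n) ℝ :=
  -((D.curvature τ P)⁻¹ * D.gradOffset τ P)

theorem gradFactor_eq (D : Data n m) (τ : TimeSetting) (K : Matrix (Fin m) (Fin n) ℝ)
    (P : Matrix (Fin n) (Fin n) ℝ) :
    D.gradFactor τ K P = D.curvature τ P * K + D.gradOffset τ P := by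
  cases τ
  · rfl
  · simp only [gradFactor, curvature, gradOffset, Matrix.mul_add, Matrix.add_mul, Matrix.mul_assoc]
    abel

theorem gradFactor_greedyGain {D : Data n m} (hR : D.R.PosDef) (τ : TimeSetting)
    {P : Matrix (Fin n) (Fin n) ℝ} (hP : P.PosSemidef) :
    D.gradFactor τ (D.greedyGain τ P) P = 0 := by
  have hu := (Matrix.isUnit_iff_isUnit_det _).1 (posDef_curvature (D := D) hR τ hP).isUnit
  rw [gradFactor_eq, greedyGain, Matrix.mul_neg, ← Matrix.mul_assoc, Matrix.mul_nonsing_inv _ hu,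
    Matrix.one_mul, neg_add_cancel]

theorem continuousOn_greedyGain {D : Data n m} (hR : D.R.PosDef) (τ : TimeSetting) :
    ContinuousOn (D.greedyGain τ) {P | P.PosSemidef} := by
  have h1 : Continuous (D.curvature τ) := by
    cases τ
    · exact continuous_const (y := D.R)
    · change Continuous fun P => D.R + D.Bᵀ * P * D.B
      fun_prop
  have h2 : Continuous (D.gradOffset τ) := by
    cases τ
    · change Continuous fun P => D.Bᵀ * P
      fun_prop
    · change Continuous fun P => D.Bᵀ * P * D.A
      fun_prop
  have h3 : ContinuousOn (fun P => (D.curvature τ P)⁻¹) {P | P.PosSemidef} := by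
    simp only [Matrix.inv_def, Ring.inverse_eq_inv']
    refine ContinuousOn.fun_smul (ContinuousOn.inv₀ ?_ ?_) ?_
    · exact h1.matrix_det.continuousOn
    · intro P hP
      exact (posDef_curvature (D := D) hR τ hP).det_pos.ne'
    · exact h1.matrix_adjugate.continuousOn
  intro P hP
  have hc : Continuous fun p : Matrix (Fin m) (Fin m) ℝ × Matrix (Fin m) (Fin n) ℝ =>
      -(p.1 * p.2) := by fun_prop
  exact hc.continuousAt.comp_continuousWithinAt
    ((h3 P hP).prodMk h2.continuousWithinAt)

theorem continuousOn_costResidual_greedyGain {D : Data n m} (hR : D.R.PosDef) (τ : TimeSetting)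
    {C : Set (Matrix (Fin n) (Fin n) ℝ)} (hC : ∀ P ∈ C, P.PosSemidef) :
    ContinuousOn (fun P => -D.costResidual τ (D.greedyGain τ P) P) C := by
  have hg := continuousOn_iff_continuous_domRestrict.1 ((continuousOn_greedyGain hR τ).mono hC)
  rw [continuousOn_iff_continuous_domRestrict]
  have hg' : Continuous fun P : C => D.greedyGain τ P := hg
  have hl : Continuous fun P : C => lyapOp τ (D.A + D.B * D.greedyGain τ P)ᵀ P :=
    continuous_lyapOp τ
      (continuous_const.add (continuous_const.matrix_mul hg')).matrix_transpose
      continuous_subtype_val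
  exact (hl.add (continuous_const.add
    ((hg'.matrix_transpose.matrix_mul continuous_const).matrix_mul hg'))).neg

/-- Completion of the square: the linear terms vanish at `G`, so for `P ⪰ 0` the greedy gain
minimizes the residual in the Loewner order. -/
theorem costResidual_eq_of_greedy {D : Data n m} (h2 : D.R.IsSymm) (τ : TimeSetting)
    {K G : Matrix (Fin m) (Fin n) ℝ} {P : Matrix (Fin n) (Fin n) ℝ} (hP : P.IsSymm)
    (hG : D.gradFactor τ G P = 0) :
    D.costResidual τ K P = D.costResidual τ G P + (K - G)ᵀ * D.curvature τ P * (K - G) := by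
  have := costResidual_add h2 τ G (K - G) hP
  rw [add_sub_cancel] at this
  rw [this, hG]
  simp

theorem exists_costMatrix {D : Data n m} {τ : TimeSetting} (hn : 0 < n)
    (h1 : D.StandingAssumption τ) {K : Matrix (Fin m) (Fin n) ℝ} (hK : K ∈ D.stabilizing τ) :
    ∃ P : Matrix (Fin n) (Fin n) ℝ, P.PosSemidef ∧ D.costResidual τ K P = 0 := by
  have hst : IsStable τ (D.A + D.B * K)ᵀ := IsStable.transpose hK
  have hC : (D.Q + Kᵀ * D.R * K).PosSemidef :=
    h1.posSemidef_Q.add (h1.posDef_R.posSemidef.conj' K)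
  obtain ⟨P, hP⟩ := hst.exists_lyapOp_eq hn (-(D.Q + Kᵀ * D.R * K))
  have hs : P.IsSymm := isSymm_of_lyapOp_isSymm (fun Y => hst.eq_zero_of_lyapOp_eq_zero hn)
    (by rw [hP]; exact hC.isSymm.neg)
  refine ⟨P, hst.posSemidef hn hs (by rwa [hP, neg_neg]), ?_⟩
  rw [costResidual, hP, neg_add_cancel]

/-- One step of policy improvement from a trace-minimal solution of the Riccati inequality cannot
lower the trace, so that solution is a fixed point of the improvement. -/
theorem exists_riccati {D : Data n m} {τ : TimeSetting} (hn : 0 < n)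
    (h1 : D.StandingAssumption τ) :
    ∃ (P : Matrix (Fin n) (Fin n) ℝ) (K : Matrix (Fin m) (Fin n) ℝ), P.PosSemidef ∧
      K ∈ D.stabilizing τ ∧ D.gradFactor τ K P = 0 ∧ D.costResidual τ K P = 0 := by
  have hR := h1.posDef_R
  have himp {K : Matrix (Fin m) (Fin n) ℝ} {P : Matrix (Fin n) (Fin n) ℝ} (hP : P.PosSemidef)
      (h0 : D.costResidual τ K P = 0) :
      (-D.costResidual τ (D.greedyGain τ P) P).PosSemidef := by
    have := costResidual_eq_of_greedy hR.posSemidef.isSymm τ (K := K) hP.isSymm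
      (gradFactor_greedyGain hR τ hP)
    rw [h0] at this
    rw [neg_eq_of_add_eq_zero_right this.symm]
    exact (posDef_curvature hR τ hP).posSemidef.conj' _
  obtain ⟨K₀, hK₀⟩ := h1.stabilizable
  obtain ⟨P₀, hP₀, h₀⟩ := exists_costMatrix hn h1 hK₀
  -- The cost matrix of any stabilizing gain is feasible by `himp`; its trace serves as the cutoff
  -- that makes the feasible set compact and nonempty.
  set C : Set (Matrix (Fin n) (Fin n) ℝ) := {P | P.PosSemidef ∧ P.trace ≤ P₀.trace}
  have hres : ContinuousOn (fun P => -D.costResidual τ (D.greedyGain τ P) P) C :=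
    continuousOn_costResidual_greedyGain hR τ fun P hP => hP.1
  have hcpt : IsCompact (C ∩ (fun P => -D.costResidual τ (D.greedyGain τ P) P) ⁻¹'
      {S | S.PosSemidef}) :=
    (isCompact_posSemidef_trace_le _).of_isClosed_subset
      (hres.preimage_isClosed_of_isClosed (isCompact_posSemidef_trace_le _).isClosed
        isClosed_setOf_posSemidef) Set.inter_subset_left
  obtain ⟨P, ⟨⟨hP, hPt⟩, hPS⟩, hmin⟩ := hcpt.exists_isMinOn
    ⟨P₀, ⟨hP₀, le_rfl⟩, himp hP₀ h₀⟩ (continuous_id.matrix_trace.continuousOn)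
  have hK := mem_stabilizing_of_costResidual hn h1 hP hPS
  obtain ⟨P', hP', h'⟩ := exists_costMatrix hn h1 hK
  have hle : (P - P').PosSemidef := by
    refine IsStable.posSemidef hn (IsStable.transpose hK) (hP.isSymm.sub hP'.isSymm) ?_
    have : D.costResidual τ (D.greedyGain τ P) P =
        lyapOp τ (D.A + D.B * D.greedyGain τ P)ᵀ (P - P') := by
      rw [lyapOp_sub, ← sub_zero (D.costResidual τ _ P), ← h', costResidual, costResidual,
        add_sub_add_right_eq_sub]
    rw [← this]
    exact hPS
  have htr : P'.trace ≤ P.trace := by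
    have := hle.trace_nonneg
    rw [Matrix.trace_sub] at this
    linarith
  -- `P'` is feasible too, so minimality of `P` applies; together with `P' ⪯ P` it forces equality.
  have hle' : P.trace ≤ P'.trace := hmin ⟨⟨hP', htr.trans hPt⟩, himp hP' h'⟩
  have heq : P = P' := by
    rw [← sub_eq_zero, ← hle.trace_eq_zero_iff, Matrix.trace_sub]
    linarith
  exact ⟨P, D.greedyGain τ P, hP, hK, gradFactor_greedyGain hR τ hP, by rw [← heq] at h'; exact h'⟩

end Data

/-! ### Trace inequalities and extreme eigenvalues -/

/-- `Tr (A B) = Tr (B^{1/2} A B^{1/2})`. -/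
theorem _root_.Matrix.PosSemidef.trace_mul_nonneg {A B : Matrix (Fin n) (Fin n) ℝ}
    (hA : A.PosSemidef) (hB : B.PosSemidef) : 0 ≤ (A * B).trace := by
  have hs : psdSqrt B * psdSqrt B = B := by
    open scoped MatrixOrder in
    exact CFC.sqrt_mul_sqrt_self B hB.nonneg
  have hsym : (psdSqrt B).PosSemidef := by
    open scoped MatrixOrder in
    exact Matrix.nonneg_iff_posSemidef.1 (CFC.sqrt_nonneg B)
  have h := (hA.conj (psdSqrt B)).trace_nonneg
  rwa [hsym.isSymm.eq, Matrix.trace_mul_comm, ← Matrix.mul_assoc, hs, Matrix.trace_mul_comm] at h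

theorem _root_.Matrix.IsSymm.isHermitian_real {M : Matrix (Fin n) (Fin n) ℝ} (h : M.IsSymm) :
    M.IsHermitian := by
  rwa [Matrix.IsHermitian, Matrix.conjTranspose_eq_transpose_of_trivial]

theorem posSemidef_of_spectrum {M : Matrix (Fin n) (Fin n) ℝ} (hM : M.IsSymm)
    (h : ∀ r ∈ spectrum ℝ M, 0 ≤ r) : M.PosSemidef :=
  hM.isHermitian_real.posSemidef_iff_eigenvalues_nonneg.2 fun i =>
    h _ (hM.isHermitian_real.eigenvalues_mem_spectrum_real i)

theorem isSymm_smul_one (c : ℝ) : (c • (1 : Matrix (Fin n) (Fin n) ℝ)).IsSymm := by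
  simp [Matrix.IsSymm]

theorem posSemidef_sub_lamMin {M : Matrix (Fin n) (Fin n) ℝ} (hM : M.IsSymm) :
    (M - lamMin M • (1 : Matrix (Fin n) (Fin n) ℝ)).PosSemidef := by
  refine posSemidef_of_spectrum (hM.sub (isSymm_smul_one _)) fun r hr => ?_
  have h : r + lamMin M ∈ spectrum ℝ M := by
    rw [spectrum.add_mem_iff, Algebra.algebraMap_eq_smul_one, neg_add_eq_sub]
    exact hr
  have : lamMin M ≤ r + lamMin M := csInf_le (Matrix.finite_real_spectrum).bddBelow h
  linarith

theorem posSemidef_lamMax_sub {M : Matrix (Fin n) (Fin n) ℝ} (hM : M.IsSymm) :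
    (lamMax M • (1 : Matrix (Fin n) (Fin n) ℝ) - M).PosSemidef := by
  refine posSemidef_of_spectrum ((isSymm_smul_one _).sub hM) fun r hr => ?_
  have h : lamMax M - r ∈ spectrum ℝ M := by
    rw [spectrum.mem_iff] at hr ⊢
    intro hu
    refine hr ?_
    convert hu.neg using 1
    simp only [Algebra.algebraMap_eq_smul_one, sub_smul]
    abel
  have : lamMax M - r ≤ lamMax M := le_csSup (Matrix.finite_real_spectrum).bddAbove h
  linarith

theorem spectrum_real_nonempty (hn : 0 < n) {M : Matrix (Fin n) (Fin n) ℝ} (hM : M.IsSymm) :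
    (spectrum ℝ M).Nonempty :=
  ⟨_, hM.isHermitian_real.eigenvalues_mem_spectrum_real ⟨0, hn⟩⟩

theorem spectrum_pos_of_posDef {M : Matrix (Fin n) (Fin n) ℝ} (hM : M.PosDef) {r : ℝ}
    (hr : r ∈ spectrum ℝ M) : 0 < r := by
  rw [hM.isHermitian.spectrum_real_eq_range_eigenvalues] at hr
  obtain ⟨i, rfl⟩ := hr
  exact hM.eigenvalues_pos i

theorem lamMin_pos (hn : 0 < n) {M : Matrix (Fin n) (Fin n) ℝ} (hM : M.PosDef) : 0 < lamMin M :=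
  spectrum_pos_of_posDef hM ((spectrum_real_nonempty hn hM.posSemidef.isSymm).csInf_mem
    (Matrix.finite_real_spectrum))

theorem lamMax_pos (hn : 0 < n) {M : Matrix (Fin n) (Fin n) ℝ} (hM : M.PosDef) : 0 < lamMax M :=
  spectrum_pos_of_posDef hM ((spectrum_real_nonempty hn hM.posSemidef.isSymm).csSup_mem
    (Matrix.finite_real_spectrum))

theorem trace_transpose_mul_eq_sum (M N : Matrix (Fin m) (Fin n) ℝ) :
    (Mᵀ * N).trace = ∑ p : Fin m × Fin n, M p.1 p.2 * N p.1 p.2 := by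
  simp only [Matrix.trace, Matrix.diag, Matrix.mul_apply, Matrix.transpose_apply]
  rw [Finset.sum_comm, Fintype.sum_prod_type]

theorem trace_transpose_mul_self_nonneg (M : Matrix (Fin m) (Fin n) ℝ) :
    0 ≤ (Mᵀ * M).trace := by
  rw [trace_transpose_mul_eq_sum]
  exact Finset.sum_nonneg fun p _ => mul_self_nonneg _

theorem eq_zero_of_trace_transpose_mul_self {M : Matrix (Fin m) (Fin n) ℝ}
    (h : (Mᵀ * M).trace = 0) : M = 0 := by
  rwa [← Matrix.conjTranspose_eq_transpose_of_trivial,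
    Matrix.trace_conjTranspose_mul_self_eq_zero_iff] at h

theorem sq_trace_transpose_mul_le (M N : Matrix (Fin m) (Fin n) ℝ) :
    (Mᵀ * N).trace ^ 2 ≤ (Mᵀ * M).trace * (Nᵀ * N).trace := by
  simp only [trace_transpose_mul_eq_sum, ← sq]
  exact Finset.sum_mul_sq_le_sq_mul_sq _ _ _

theorem frobNorm_sq (M : Matrix (Fin m) (Fin n) ℝ) : frobNorm M ^ 2 = (Mᵀ * M).trace :=
  Real.sq_sqrt (trace_transpose_mul_self_nonneg M)

theorem posSemidef_transpose_mul_self (M : Matrix (Fin m) (Fin n) ℝ) : (Mᵀ * M).PosSemidef := by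
  simpa [Matrix.conjTranspose_eq_transpose_of_trivial] using
    Matrix.posSemidef_conjTranspose_mul_self M

/-- `X² - c² = (X - c)² + 2c (X - c)`. -/
theorem posSemidef_sq_sub {X : Matrix (Fin n) (Fin n) ℝ} {c : ℝ} (hc : 0 ≤ c) (hX : X.IsSymm)
    (h : (X - c • (1 : Matrix (Fin n) (Fin n) ℝ)).PosSemidef) :
    (X * X - c ^ 2 • (1 : Matrix (Fin n) (Fin n) ℝ)).PosSemidef := by
  have h1 := (posSemidef_transpose_mul_self (X - c • (1 : Matrix (Fin n) (Fin n) ℝ))).add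
    (h.smul (show 0 ≤ 2 * c by positivity))
  convert h1 using 1
  rw [Matrix.transpose_sub, hX.eq, (isSymm_smul_one c).eq]
  simp only [Matrix.mul_sub, Matrix.sub_mul, smul_sub, Matrix.mul_smul, Matrix.smul_mul,
    Matrix.mul_one, Matrix.one_mul, smul_smul]
  module

/-- `c² - X² = c (c - X) + c⁻¹ ((c - X) X (c - X) + X (c - X) X)`, each term being positive
semidefinite. -/
theorem posSemidef_sub_sq {X : Matrix (Fin n) (Fin n) ℝ} {c : ℝ} (hc : 0 < c)
    (hX : X.PosSemidef) (h : (c • (1 : Matrix (Fin n) (Fin n) ℝ) - X).PosSemidef) :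
    (c ^ 2 • (1 : Matrix (Fin n) (Fin n) ℝ) - X * X).PosSemidef := by
  have h1 := (h.smul hc.le).add (((hX.conj (c • (1 : Matrix (Fin n) (Fin n) ℝ) - X)).add
    (h.conj X)).smul (inv_pos.2 hc).le)
  convert h1 using 1
  rw [h.isSymm.eq, hX.isSymm.eq]
  have : (c • (1 : Matrix (Fin n) (Fin n) ℝ) - X) * X * (c • (1 : Matrix (Fin n) (Fin n) ℝ) - X) +
      X * (c • (1 : Matrix (Fin n) (Fin n) ℝ) - X) * X = c • (c • X - X * X) := by
    simp only [Matrix.mul_sub, Matrix.sub_mul, smul_sub, Matrix.mul_smul, Matrix.smul_mul,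
      Matrix.mul_one, Matrix.one_mul, smul_smul]
    module
  rw [this, smul_smul, inv_mul_cancel₀ hc.ne']
  module

theorem trace_mul_mul_transpose (M : Matrix (Fin m) (Fin n) ℝ) (X : Matrix (Fin n) (Fin n) ℝ)
    (hX : X.IsSymm) : ((M * X)ᵀ * (M * X)).trace = (Mᵀ * M * (X * X)).trace := by
  rw [Matrix.transpose_mul, hX.eq, Matrix.mul_assoc, Matrix.trace_mul_comm]
  simp only [Matrix.mul_assoc]

theorem trace_mul_smul_one (M : Matrix (Fin n) (Fin n) ℝ) (c : ℝ) :
    (M * c • (1 : Matrix (Fin n) (Fin n) ℝ)).trace = c * M.trace := by simp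

theorem lamMin_sq_mul_le (M : Matrix (Fin m) (Fin n) ℝ) (hn : 0 < n)
    {X : Matrix (Fin n) (Fin n) ℝ} (hX : X.PosDef) :
    lamMin X ^ 2 * (Mᵀ * M).trace ≤ ((M * X)ᵀ * (M * X)).trace := by
  have hs := hX.posSemidef.isSymm
  have := (posSemidef_transpose_mul_self M).trace_mul_nonneg
    (posSemidef_sq_sub (lamMin_pos hn hX).le hs (posSemidef_sub_lamMin hs))
  rw [Matrix.mul_sub, Matrix.trace_sub, trace_mul_smul_one] at this
  rw [trace_mul_mul_transpose M X hs]
  linarith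

theorem le_lamMax_sq_mul (M : Matrix (Fin m) (Fin n) ℝ) (hn : 0 < n)
    {X : Matrix (Fin n) (Fin n) ℝ} (hX : X.PosDef) :
    ((M * X)ᵀ * (M * X)).trace ≤ lamMax X ^ 2 * (Mᵀ * M).trace := by
  have hs := hX.posSemidef.isSymm
  have := (posSemidef_transpose_mul_self M).trace_mul_nonneg
    (posSemidef_sub_sq (lamMax_pos hn hX) hX.posSemidef (posSemidef_lamMax_sub hs))
  rw [Matrix.mul_sub, Matrix.trace_sub, trace_mul_smul_one] at this
  rw [trace_mul_mul_transpose M X hs]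
  linarith

/-- Replace `S` by `R`, then `R` by `λ_min(R)`, then `X` by `λ_min(X)`; each replacement lowers the
trace. -/
theorem lamMin_mul_lamMin_mul_le (hm : 0 < m) {Δ : Matrix (Fin m) (Fin n) ℝ}
    {S R : Matrix (Fin m) (Fin m) ℝ} {X : Matrix (Fin n) (Fin n) ℝ} (hR : R.PosDef)
    (hS : (S - R).PosSemidef) (hX : X.PosSemidef) :
    lamMin R * lamMin X * (Δᵀ * Δ).trace ≤ (Δᵀ * S * Δ * X).trace := by
  have h1 := (hS.conj' Δ).trace_mul_nonneg hX
  have h2 := ((posSemidef_sub_lamMin hR.posSemidef.isSymm).conj' Δ).trace_mul_nonneg hX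
  have h3 := (posSemidef_transpose_mul_self Δ).trace_mul_nonneg (posSemidef_sub_lamMin hX.isSymm)
  simp only [Matrix.mul_sub, Matrix.sub_mul, Matrix.trace_sub, Matrix.mul_smul, Matrix.smul_mul,
    Matrix.mul_one, Matrix.trace_smul, smul_eq_mul] at h1 h2 h3
  have := mul_le_mul_of_nonneg_left (sub_nonneg.1 h3) (lamMin_pos hm hR).le
  linarith

/-! ### The cost and its exact difference formula -/

namespace Data

theorem isLyapunovSolution_iff {D : Data n m} {τ : TimeSetting} {K : Matrix (Fin m) (Fin n) ℝ}
    {X : Matrix (Fin n) (Fin n) ℝ} :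
    D.IsLyapunovSolution τ K X ↔ X.IsSymm ∧ lyapOp τ (D.A + D.B * K) X + D.W = 0 := by
  refine and_congr_right fun hX => ?_
  rw [Matrix.transpose_fromRows, Matrix.fromRows_mul, Matrix.fromRows_mul_fromCols]
  cases τ <;> simp [Psi, lyapOp, hX.eq]

theorem existsUnique_lyapunovSolution {D : Data n m} {τ : TimeSetting} (hW : D.W.IsSymm)
    {K : Matrix (Fin m) (Fin n) ℝ} {X : Matrix (Fin n) (Fin n) ℝ}
    (hinj : ∀ Y, lyapOp τ (D.A + D.B * K) Y = 0 → Y = 0)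
    (hX : lyapOp τ (D.A + D.B * K) X = -D.W) :
    D.IsLyapunovSolution τ K X ∧ ∀ Y, D.IsLyapunovSolution τ K Y → Y = X := by
  refine ⟨isLyapunovSolution_iff.2
    ⟨isSymm_of_lyapOp_isSymm hinj (hX ▸ hW.neg), by rw [hX, neg_add_cancel]⟩, fun Y hY => ?_⟩
  refine sub_eq_zero.1 (hinj _ ?_)
  rw [lyapOp_sub, hX, eq_neg_of_add_eq_zero_left (isLyapunovSolution_iff.1 hY).2, sub_self]

theorem isLyapunovSolution_lyap {D : Data n m} {τ : TimeSetting} {K : Matrix (Fin m) (Fin n) ℝ}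
    (h : ∃ X, D.IsLyapunovSolution τ K X) : D.IsLyapunovSolution τ K (D.lyap τ K) := by
  rw [lyap, dif_pos h]
  exact h.choose_spec

theorem exists_lyapunov {D : Data n m} {τ : TimeSetting} (hn : 0 < n)
    (hW : D.W.IsSymm) {K : Matrix (Fin m) (Fin n) ℝ} (hK : K ∈ D.stabilizing τ) :
    (∃! X, D.IsLyapunovSolution τ K X) ∧ D.IsLyapunovSolution τ K (D.lyap τ K) := by
  have hK' : IsStable τ (D.A + D.B * K) := hK
  obtain ⟨X, hX⟩ := hK'.exists_lyapOp_eq hn (-D.W)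
  have h := existsUnique_lyapunovSolution hW (fun Y => hK'.eq_zero_of_lyapOp_eq_zero hn) hX
  exact ⟨⟨X, h⟩, isLyapunovSolution_lyap ⟨X, h.1⟩⟩

theorem trace_lyapOp_transpose_mul (τ : TimeSetting) (M P X : Matrix (Fin n) (Fin n) ℝ) :
    (lyapOp τ Mᵀ P * X).trace = (P * lyapOp τ M X).trace := by
  cases τ
  · simp only [lyapOp, Matrix.transpose_transpose, Matrix.add_mul, Matrix.mul_add,
      Matrix.trace_add]
    rw [Matrix.mul_assoc Mᵀ, Matrix.trace_mul_comm Mᵀ, Matrix.mul_assoc P M X,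
      Matrix.mul_assoc P X, add_comm]
  · simp only [lyapOp, Matrix.transpose_transpose, Matrix.sub_mul, Matrix.mul_sub,
      Matrix.trace_sub]
    rw [Matrix.mul_assoc (Mᵀ * P), Matrix.mul_assoc Mᵀ, Matrix.trace_mul_comm Mᵀ]
    simp only [Matrix.mul_assoc]

/-- Lagrangian duality: `P` is a free multiplier for the Lyapunov constraint. Fixing one `P` for two
gains makes their costs comparable. -/
theorem cost_eq_trace_costResidual {D : Data n m} {τ : TimeSetting} (hQ : D.Q.IsSymm)
    (hR : D.R.IsSymm) {K : Matrix (Fin m) (Fin n) ℝ}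
    (hX : D.IsLyapunovSolution τ K (D.lyap τ K)) (P : Matrix (Fin n) (Fin n) ℝ) :
    D.cost τ K = (D.costResidual τ K P * D.lyap τ K).trace + (P * D.W).trace := by
  have h := eq_neg_of_add_eq_zero_left (isLyapunovSolution_iff.1 hX).2
  rw [cost, costResidual, Matrix.add_mul, Matrix.trace_add, trace_lyapOp_transpose_mul, h]
  simp [hQ.eq, hR.eq, Matrix.mul_assoc]

/-- The cost difference of two gains, in terms of the cost matrix of one of them. -/
theorem cost_eq_cost_add {D : Data n m} {τ : TimeSetting} (hQ : D.Q.IsSymm) (hR : D.R.IsSymm)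
    {K₀ K : Matrix (Fin m) (Fin n) ℝ} {P : Matrix (Fin n) (Fin n) ℝ} (hP : P.IsSymm)
    (h₀ : D.costResidual τ K₀ P = 0) (hX₀ : D.IsLyapunovSolution τ K₀ (D.lyap τ K₀))
    (hX : D.IsLyapunovSolution τ K (D.lyap τ K)) :
    D.cost τ K = D.cost τ K₀ +
      2 * ((D.gradFactor τ K₀ P)ᵀ * ((K - K₀) * D.lyap τ K)).trace +
      ((K - K₀)ᵀ * D.curvature τ P * (K - K₀) * D.lyap τ K).trace := by
  have h1 := costResidual_add hR τ K₀ (K - K₀) hP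
  rw [add_sub_cancel, h₀, zero_add] at h1
  rw [cost_eq_trace_costResidual hQ hR hX P, cost_eq_trace_costResidual hQ hR hX₀ P, h₀, h1]
  have h2 : ((K - K₀)ᵀ * D.gradFactor τ K₀ P * D.lyap τ K).trace =
      ((D.gradFactor τ K₀ P)ᵀ * ((K - K₀) * D.lyap τ K)).trace := by
    rw [← Matrix.trace_transpose, Matrix.transpose_mul, Matrix.transpose_mul,
      Matrix.transpose_transpose, hX.1.eq, Matrix.trace_mul_comm, Matrix.mul_assoc]
  simp only [Matrix.add_mul, Matrix.trace_add, h2, Matrix.zero_mul, Matrix.trace_zero]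
  rw [Matrix.mul_assoc (D.gradFactor τ K₀ P)ᵀ]
  ring

end Data

/-! ### Continuity of the Lyapunov solution and the gradient of the cost -/

/-- Carathéodory's criterion: the remainder is `l (y - x) * (h y - h x)`, a big O of `y - x` times
little o of `1`. Hence `h` need not be differentiable. -/
theorem hasFDerivAt_mul_of_continuousAt {E : Type*} [NormedAddCommGroup E] [NormedSpace ℝ E]
    (l : E →L[ℝ] ℝ) {h : E → ℝ} {x : E} (hh : ContinuousAt h x) :
    HasFDerivAt (fun y => l (y - x) * h y) (h x • l) x := by
  rw [hasFDerivAt_iff_isLittleO]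
  have h1 : (fun y => h y - h x) =o[𝓝 x] fun _ => (1 : ℝ) := by
    rw [Asymptotics.isLittleO_one_iff]
    exact tendsto_sub_nhds_zero_iff.2 hh
  have h2 := (l.isBigO_comp (fun y => y - x) (𝓝 x)).norm_right.mul_isLittleO h1
  simp only [mul_one] at h2
  refine h2.of_norm_right.congr_left fun y => ?_
  simp
  ring

/-- If a continuous family of linear equations has an injective member, then the equations near it
have a continuous family of solutions. -/
theorem exists_continuousAt_solution {α E : Type*} [TopologicalSpace α] [NormedAddCommGroup E]
    [NormedSpace ℝ E] [FiniteDimensional ℝ E] (T : α → E →ₗ[ℝ] E)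
    (hT : ∀ y, Continuous fun a => T a y) (c : E) {a₀ : α} (hinj : Function.Injective (T a₀)) :
    ∃ X : α → E, ContinuousAt X a₀ ∧
      ∀ᶠ a in 𝓝 a₀, Function.Injective (T a) ∧ T a (X a) = c := by
  have hcomplete : CompleteSpace E := FiniteDimensional.complete ℝ _
  let S (a : α) : E →L[ℝ] E := LinearMap.toContinuousLinearMap (T a)
  have hS : Continuous S := continuous_clm_apply.2 hT
  have hu : IsUnit (S a₀) := by
    let e := (LinearEquiv.ofBijective (T a₀)
      ⟨hinj, LinearMap.surjective_of_injective hinj⟩).toContinuousLinearEquiv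
    refine ⟨ContinuousLinearEquiv.toUnit e, ?_⟩
    ext1 y
    rfl
  refine ⟨fun a => Ring.inverse (S a) c, ?_, ?_⟩
  · have h1 : ContinuousAt (fun a => Ring.inverse (S a)) a₀ := by
      refine ContinuousAt.comp (g := Ring.inverse) ?_ hS.continuousAt
      obtain ⟨u, hu⟩ := hu
      rw [← hu]
      exact NormedRing.inverse_continuousAt u
    exact h1.clm_apply continuousAt_const
  · filter_upwards [hS.continuousAt.preimage_mem_nhds (Units.isOpen.mem_nhds hu)] with a ha
    have ha' : IsUnit (S a) := ha
    constructor
    · refine (injective_iff_map_eq_zero _).2 fun y hy => ?_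
      have h1 : (Ring.inverse (S a) * S a) y = Ring.inverse (S a) 0 := congrArg _ hy
      rwa [Ring.inverse_mul_cancel _ ha', map_zero] at h1
    · exact congrArg (fun L : E →L[ℝ] E => L c) (Ring.mul_inverse_cancel _ ha')

theorem hasFDerivAt_of_eventuallyEq_sum_mul {f : Matrix (Fin m) (Fin n) ℝ → ℝ}
    {H : Matrix (Fin m) (Fin n) ℝ → Matrix (Fin m) (Fin n) ℝ}
    {K₀ : Matrix (Fin m) (Fin n) ℝ} (hH : ContinuousAt H K₀) (c : ℝ)
    (hf : f =ᶠ[𝓝 K₀] fun K => c + ∑ p : Fin m × Fin n, (K - K₀) p.1 p.2 * H K p.1 p.2) :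
    HasFDerivAt f (∑ p : Fin m × Fin n, H K₀ p.1 p.2 •
      LinearMap.toContinuousLinearMap (Matrix.entryLinearMap ℝ ℝ p.1 p.2)) K₀ := by
  let _ : NormedAddCommGroup (Matrix (Fin m) (Fin n) ℝ) := Matrix.normedAddCommGroup
  let _ : NormedSpace ℝ (Matrix (Fin m) (Fin n) ℝ) := Matrix.normedSpace
  refine HasFDerivAt.congr_of_eventuallyEq (HasFDerivAt.const_add c
    (HasFDerivAt.fun_sum fun p _ => ?_)) hf
  have hp : ContinuousAt (fun K => H K p.1 p.2) K₀ :=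
    (continuous_id.matrix_elem p.1 p.2).continuousAt.comp hH
  exact hasFDerivAt_mul_of_continuousAt
    (LinearMap.toContinuousLinearMap (Matrix.entryLinearMap ℝ ℝ p.1 p.2)) hp

/-- Near a matrix with injective Lyapunov operator, the Lyapunov equation has a continuous family of
solutions. -/
theorem exists_continuousAt_lyapOp_eq (τ : TimeSetting)
    (C : Matrix (Fin n) (Fin n) ℝ) {M₀ : Matrix (Fin n) (Fin n) ℝ}
    (hinj : ∀ Y, lyapOp τ M₀ Y = 0 → Y = 0) :
    ∃ X : Matrix (Fin n) (Fin n) ℝ → Matrix (Fin n) (Fin n) ℝ, ContinuousAt X M₀ ∧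
      ∀ᶠ M in 𝓝 M₀, (∀ Y, lyapOp τ M Y = 0 → Y = 0) ∧ lyapOp τ M (X M) = C := by
  have h : ∃ X : Matrix (Fin n) (Fin n) ℝ → Matrix (Fin n) (Fin n) ℝ, ContinuousAt X M₀ ∧
      ∀ᶠ M in 𝓝 M₀, Function.Injective (lyapLin τ M) ∧ lyapLin τ M (X M) = C := by
    let _ : NormedAddCommGroup (Matrix (Fin n) (Fin n) ℝ) := Matrix.normedAddCommGroup
    let _ : NormedSpace ℝ (Matrix (Fin n) (Fin n) ℝ) := Matrix.normedSpace
    exact exists_continuousAt_solution (lyapLin τ)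
      (fun Y => continuous_lyapOp τ continuous_id continuous_const) C
      ((injective_iff_map_eq_zero _).2 hinj)
  obtain ⟨X, hX, hev⟩ := h
  exact ⟨X, hX, hev.mono fun M hM => ⟨fun Y => (injective_iff_map_eq_zero _).1 hM.1 Y, hM.2⟩⟩

theorem abs_quad_le {Y : Matrix (Fin n) (Fin n) ℝ} {ε : ℝ} (h : ∀ i j, |Y i j| ≤ ε)
    (x : Fin n → ℝ) : |x ⬝ᵥ Y *ᵥ x| ≤ ε * (n * (x ⬝ᵥ x)) := by
  have h1 : |x ⬝ᵥ Y *ᵥ x| ≤ ∑ i, ∑ j, |x i| * (ε * |x j|) := by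
    simp only [dotProduct, Matrix.mulVec, Finset.mul_sum]
    refine (Finset.abs_sum_le_sum_abs _ _).trans (Finset.sum_le_sum fun i _ =>
      (Finset.abs_sum_le_sum_abs _ _).trans (Finset.sum_le_sum fun j _ => ?_))
    rw [abs_mul, abs_mul]
    gcongr
    exact h i j
  refine h1.trans ?_
  rcases isEmpty_or_nonempty (Fin n) with hn | ⟨⟨i₀⟩⟩
  · simp [dotProduct]
  have hε : 0 ≤ ε := (abs_nonneg _).trans (h i₀ i₀)
  have h2 : ∑ i, ∑ j, |x i| * (ε * |x j|) = ε * (∑ i, |x i|) ^ 2 := by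
    rw [sq, Finset.sum_mul_sum, Finset.mul_sum]
    refine Finset.sum_congr rfl fun i _ => ?_
    rw [Finset.mul_sum]
    exact Finset.sum_congr rfl fun j _ => by ring
  rw [h2]
  refine mul_le_mul_of_nonneg_left ?_ hε
  have h3 := sq_sum_le_card_mul_sum_sq (s := Finset.univ) (f := fun i => |x i|)
  simpa [dotProduct, sq] using h3

theorem eventually_posDef {α : Type*} {l : Filter α} {X : α → Matrix (Fin n) (Fin n) ℝ}
    {X₀ : Matrix (Fin n) (Fin n) ℝ} (hX₀ : X₀.PosDef) (hX : Tendsto X l (𝓝 X₀))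
    (hsymm : ∀ᶠ a in l, (X a).IsSymm) : ∀ᶠ a in l, (X a).PosDef := by
  rcases Nat.eq_zero_or_pos n with rfl | hn
  · filter_upwards [hsymm] with a ha
    exact Matrix.PosDef.of_dotProduct_mulVec_pos ha.isHermitian_real fun x hx =>
      absurd (Subsingleton.elim x 0) hx
  have hlam := lamMin_pos hn hX₀
  have hn' : (0 : ℝ) < n := by exact_mod_cast hn
  -- By `abs_quad_le`, an entrywise perturbation of at most `ε` changes the form by at most half of
  -- `lamMin X₀ * (x ⬝ᵥ x)`.
  set ε := lamMin X₀ / (2 * n) with hε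
  have hε0 : 0 < ε := by positivity
  have hev (i j : Fin n) : ∀ᶠ a in l, |(X a - X₀) i j| ≤ ε := by
    have h1 : Tendsto (fun a => |(X a - X₀) i j|) l (𝓝 |(X₀ - X₀) i j|) :=
      ((((continuous_id.sub continuous_const).matrix_elem i j).abs).tendsto X₀).comp hX
    rw [sub_self, Matrix.zero_apply, abs_zero] at h1
    exact (h1.eventually_lt_const hε0).mono fun a ha => ha.le
  filter_upwards [hsymm, eventually_all.2 fun i => eventually_all.2 (hev i)] with a ha hae
  refine Matrix.PosDef.of_dotProduct_mulVec_pos ha.isHermitian_real fun x hx => ?_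
  have h1 := abs_le.1 (abs_quad_le hae x)
  have h2 := (posSemidef_sub_lamMin hX₀.posSemidef.isSymm).quad_nonneg x
  have h3 : 0 < x ⬝ᵥ x := by
    rcases (show 0 ≤ x ⬝ᵥ x from Finset.sum_nonneg fun i _ => mul_self_nonneg (x i)).lt_or_eq
      with h | h
    · exact h
    · exact absurd (dotProduct_self_eq_zero.1 h.symm) hx
  simp only [Matrix.sub_mulVec, dotProduct_sub, Matrix.smul_mulVec, Matrix.one_mulVec,
    dotProduct_smul, smul_eq_mul] at h1 h2
  have h4 : ε * (n * (x ⬝ᵥ x)) = lamMin X₀ * (x ⬝ᵥ x) / 2 := by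
    rw [hε]; field_simp
  have := mul_pos hlam h3
  rw [star_trivial]
  linarith [h1.1]

namespace Data

/-- Openness of the stabilizing set needs no perturbation theory of eigenvalues: nearby Lyapunov
solutions stay positive definite, and `PosDefAssumption` turns this back into stability. -/
theorem continuousAt_lyap {D : Data n m} {τ : TimeSetting} (hn : 0 < n)
    (hW : D.W.IsSymm) (h2 : D.PosDefAssumption τ) {K₀ : Matrix (Fin m) (Fin n) ℝ}
    (hK₀ : K₀ ∈ D.stabilizing τ) :
    ContinuousAt (D.lyap τ) K₀ ∧ ∀ᶠ K in 𝓝 K₀, K ∈ D.stabilizing τ := by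
  have hst : IsStable τ (D.A + D.B * K₀) := hK₀
  obtain ⟨X, hX, hev⟩ := exists_continuousAt_lyapOp_eq τ (-D.W)
    fun Y => hst.eq_zero_of_lyapOp_eq_zero hn
  have hM : ContinuousAt (fun K => D.A + D.B * K) K₀ :=
    (continuous_const.add (continuous_const.matrix_mul continuous_id)).continuousAt
  have hXK : ContinuousAt (fun K => X (D.A + D.B * K)) K₀ :=
    ContinuousAt.comp (g := X) hX hM
  have hsol : ∀ᶠ K in 𝓝 K₀, D.IsLyapunovSolution τ K (X (D.A + D.B * K)) ∧
      D.lyap τ K = X (D.A + D.B * K) := by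
    filter_upwards [hM.eventually hev] with K hK
    have h := existsUnique_lyapunovSolution hW hK.1 hK.2
    exact ⟨h.1, h.2 _ (isLyapunovSolution_lyap ⟨_, h.1⟩)⟩
  have hpd : ∀ᶠ K in 𝓝 K₀, (X (D.A + D.B * K)).PosDef :=
    eventually_posDef ((h2 _ _ hsol.self_of_nhds.1).1 hK₀) hXK
      (hsol.mono fun K hK => hK.1.1)
  refine ⟨hXK.congr (hsol.mono fun K hK => hK.2.symm), ?_⟩
  filter_upwards [hsol, hpd] with K hK hKpd
  exact (h2 _ _ hK.1).2 hKpd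

theorem differentiableAt_cost_and_matGradient {D : Data n m} {τ : TimeSetting} (hn : 0 < n)
    (h1 : D.StandingAssumption τ) (h2 : D.PosDefAssumption τ) {K₀ : Matrix (Fin m) (Fin n) ℝ}
    (hK₀ : K₀ ∈ D.stabilizing τ) {P : Matrix (Fin n) (Fin n) ℝ} (hP : P.IsSymm)
    (h₀ : D.costResidual τ K₀ P = 0) :
    DifferentiableAt ℝ (D.cost τ) K₀ ∧
      matGradient (D.cost τ) K₀ = (2 : ℝ) • (D.gradFactor τ K₀ P * D.lyap τ K₀) := by
  have hW := h1.posSemidef_W.isSymm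
  have hlyap {K} (hK : K ∈ D.stabilizing τ) := (exists_lyapunov hn hW hK).2
  obtain ⟨hcont, hev⟩ := continuousAt_lyap hn hW h2 hK₀
  -- Chosen so that the difference formula reads `J(K) = J(K₀) + ⟨K - K₀, H K⟩`; the gradient is
  -- then `H K₀`, where the curvature term vanishes.
  set H : Matrix (Fin m) (Fin n) ℝ → Matrix (Fin m) (Fin n) ℝ := fun K =>
    (2 : ℝ) • (D.gradFactor τ K₀ P * D.lyap τ K) +
      D.curvature τ P * (K - K₀) * D.lyap τ K with hH
  have hHc : ContinuousAt H K₀ := by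
    have hc : Continuous fun p : Matrix (Fin n) (Fin n) ℝ × Matrix (Fin m) (Fin n) ℝ =>
        (2 : ℝ) • (D.gradFactor τ K₀ P * p.1) + D.curvature τ P * (p.2 - K₀) * p.1 := by
      fun_prop
    exact ContinuousAt.comp (f := fun K => (D.lyap τ K, K)) hc.continuousAt
      (hcont.prodMk continuousAt_id)
  have heq : D.cost τ =ᶠ[𝓝 K₀] fun K => D.cost τ K₀ +
      ∑ p : Fin m × Fin n, (K - K₀) p.1 p.2 * H K p.1 p.2 := by
    filter_upwards [hev] with K hK
    rw [cost_eq_cost_add h1.posSemidef_Q.isSymm h1.posDef_R.posSemidef.isSymm hP h₀ (hlyap hK₀)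
      (hlyap hK), add_assoc, ← trace_transpose_mul_eq_sum, hH, Matrix.mul_add, Matrix.trace_add,
      Matrix.mul_smul, Matrix.trace_smul, smul_eq_mul]
    congr 2
    · congr 1
      rw [← Matrix.trace_transpose, Matrix.transpose_mul, Matrix.transpose_mul,
        Matrix.transpose_transpose, (hlyap hK).1.eq, Matrix.mul_assoc, Matrix.trace_mul_comm,
        Matrix.mul_assoc]
    · simp only [Matrix.mul_assoc]
  have hd := hasFDerivAt_of_eventuallyEq_sum_mul hHc _ heq
  refine ⟨hd.differentiableAt, ?_⟩
  ext i j
  have hHK₀ : H K₀ = (2 : ℝ) • (D.gradFactor τ K₀ P * D.lyap τ K₀) := by simp [hH]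
  rw [matGradient, Matrix.of_apply, hd.fderiv, ← hHK₀]
  simp [Matrix.single_apply, Fintype.sum_prod_type, ite_and]

/-! ### The optimal gain and gradient dominance -/

/-- There is an optimal gain, and the excess cost of a gain bounds its distance to it. -/
theorem exists_optimal {D : Data n m} {τ : TimeSetting} (hn : 0 < n) (hm : 0 < m)
    (h1 : D.StandingAssumption τ) (h2 : D.PosDefAssumption τ) :
    ∃ G, D.IsOptimalGain τ G ∧ ∀ K ∈ D.stabilizing τ,
      lamMin D.R * lamMin (D.lyap τ K) * ((K - G)ᵀ * (K - G)).trace ≤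
        D.cost τ K - D.cost τ G := by
  have hW := h1.posSemidef_W.isSymm
  obtain ⟨P, G, hP, hG, hE, hres⟩ := exists_riccati hn h1
  have hkey : ∀ K ∈ D.stabilizing τ,
      lamMin D.R * lamMin (D.lyap τ K) * ((K - G)ᵀ * (K - G)).trace ≤
        D.cost τ K - D.cost τ G := by
    intro K hK
    have hX := (exists_lyapunov hn hW hK).2
    have h := cost_eq_cost_add h1.posSemidef_Q.isSymm h1.posDef_R.posSemidef.isSymm hP.isSymm hres
      (exists_lyapunov hn hW hG).2 hX
    rw [hE, Matrix.transpose_zero, Matrix.zero_mul, Matrix.trace_zero, mul_zero, add_zero] at h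
    have := lamMin_mul_lamMin_mul_le hm (Δ := K - G) h1.posDef_R
      (posSemidef_curvature_sub (D := D) τ hP) ((h2 _ _ hX).1 hK).posSemidef
    linarith
  refine ⟨G, ⟨hG, fun K hK => ?_⟩, hkey⟩
  have hX := (h2 _ _ (exists_lyapunov hn hW hK).2).1 hK
  have h := hkey K hK
  have := mul_nonneg (mul_pos (lamMin_pos hm h1.posDef_R) (lamMin_pos hn hX)).le
    (trace_transpose_mul_self_nonneg (K - G))
  change D.cost τ G ≤ D.cost τ K
  linarith

end Data

/-- Here `d` is the excess cost, `g = ‖∇J‖²`, `e = ‖E‖²`, `δ = ‖K - K⋆‖²`, and `r`, `l`, `L` are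
`λ_min(R)`, `λ_min(X_K)`, `λ_max(X⋆)`. Chaining the bounds gives the claim multiplied by `d`, which
is cancelled when positive. -/
theorem gradient_dominance_of_bounds {d g e δ r l L : ℝ} (hr : 0 < r) (hl : 0 < l) (hL : 0 < L)
    (hδ : 0 ≤ δ) (hd : 0 ≤ d) (he : 0 ≤ e) (h1 : r * l * δ ≤ d)
    (h2 : d ^ 2 ≤ 4 * (e * (L ^ 2 * δ))) (h3 : 4 * (l ^ 2 * e) ≤ g) :
    r * l ^ 3 / L ^ 2 * d ≤ g := by
  have hg : 0 ≤ g := le_trans (by positivity) h3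
  rcases hd.eq_or_lt with rfl | hd
  · simpa using hg
  have h4 : r * l ^ 3 * d * d ≤ g * L ^ 2 * d := by
    calc r * l ^ 3 * d * d = r * l ^ 3 * d ^ 2 := by ring
      _ ≤ r * l ^ 3 * (4 * (e * (L ^ 2 * δ))) := by gcongr
      _ = (4 * (l ^ 2 * e)) * L ^ 2 * (r * l * δ) := by ring
      _ ≤ g * L ^ 2 * d := by gcongr
  have h5 := le_of_mul_le_mul_right h4 hd
  rw [div_mul_eq_mul_div, div_le_iff₀ (by positivity)]
  exact h5

end LQR

theorem theorem3 {n m : ℕ} (hm : 0 < m) (τ : LQR.TimeSetting) (D : LQR.Data n m)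
    (h1 : D.StandingAssumption τ) (h2 : D.PosDefAssumption τ) :
    (∀ K ∈ D.stabilizing τ,
      (∃! X, D.IsLyapunovSolution τ K X) ∧ D.IsLyapunovSolution τ K (D.lyap τ K)) ∧
    (∃! Kstar, D.IsOptimalGain τ Kstar) ∧
    ∀ Kstar, D.IsOptimalGain τ Kstar →
      D.cost τ Kstar = D.optCost τ ∧
      ∀ K ∈ D.stabilizing τ,
        DifferentiableAt ℝ (D.cost τ) K ∧
        0 < D.dominanceConst τ Kstar K ∧
        D.dominanceConst τ Kstar K * (D.cost τ K - D.optCost τ)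
          ≤ LQR.frobNorm (LQR.matGradient (D.cost τ) K) ^ 2 := by
  have hn : 0 < n := by
    rcases Nat.eq_zero_or_pos n with rfl | hn
    · exact absurd (Subsingleton.elim D.Q 0) h1.Q_ne_zero
    · exact hn
  have hW := h1.posSemidef_W.isSymm
  have hlyap {K} (hK : K ∈ D.stabilizing τ) := (LQR.Data.exists_lyapunov hn hW hK).2
  have hpd {K} (hK : K ∈ D.stabilizing τ) : (D.lyap τ K).PosDef := (h2 _ _ (hlyap hK)).1 hK
  have hlamR := LQR.lamMin_pos hm h1.posDef_R
  obtain ⟨G, hG, hquad⟩ := LQR.Data.exists_optimal hn hm h1 h2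
  have huniq : ∀ K, D.IsOptimalGain τ K → K = G := by
    intro K hK
    have h := hquad K hK.1
    have hle : D.cost τ K ≤ D.cost τ G := hK.2 hG.1
    have hpos := mul_pos hlamR (LQR.lamMin_pos hn (hpd hK.1))
    have hnn := LQR.trace_transpose_mul_self_nonneg (K - G)
    have h0 : ((K - G)ᵀ * (K - G)).trace = 0 := by
      refine le_antisymm ?_ hnn
      by_contra! hc
      have := mul_pos hpos hc
      linarith
    exact sub_eq_zero.1 (LQR.eq_zero_of_trace_transpose_mul_self h0)
  refine ⟨fun K hK => LQR.Data.exists_lyapunov hn hW hK, ⟨G, hG, huniq⟩, ?_⟩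
  intro Kstar hKstar
  obtain rfl := huniq Kstar hKstar
  have hopt : D.cost τ Kstar = D.optCost τ := by
    have : IsLeast (D.cost τ '' D.stabilizing τ) (D.cost τ Kstar) :=
      ⟨⟨Kstar, hG.1, rfl⟩, by rintro _ ⟨K, hK, rfl⟩; exact hG.2 hK⟩
    exact this.csInf_eq.symm
  refine ⟨hopt, fun K hK => ?_⟩
  obtain ⟨P, hP, hres⟩ := LQR.Data.exists_costMatrix hn h1 hK
  obtain ⟨hdiff, hgrad⟩ :=
    LQR.Data.differentiableAt_cost_and_matGradient hn h1 h2 hK hP.isSymm hres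
  have hl := LQR.lamMin_pos hn (hpd hK)
  have hL := LQR.lamMax_pos hn (hpd hG.1)
  refine ⟨hdiff, by unfold LQR.Data.dominanceConst; positivity, ?_⟩
  rw [LQR.frobNorm_sq, ← hopt, hgrad]
  have hd : 0 ≤ D.cost τ K - D.cost τ Kstar := sub_nonneg.2 (hG.2 hK)
  set E := D.gradFactor τ K P with hE
  refine LQR.gradient_dominance_of_bounds hlamR hl hL
    (LQR.trace_transpose_mul_self_nonneg (K - Kstar)) hd
    (LQR.trace_transpose_mul_self_nonneg E) (hquad K hK) ?_ ?_
  -- The difference formula based at `K` and evaluated at `Kstar`: dropping its nonnegative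
  -- curvature term bounds the excess cost by a linear term weighted with `X⋆`, not `X_K`. This is
  -- why `λ_max(X⋆)` enters the constant.
  · have hc := LQR.Data.cost_eq_cost_add h1.posSemidef_Q.isSymm h1.posDef_R.posSemidef.isSymm
      hP.isSymm hres (hlyap hK) (hlyap hG.1)
    have hnn := ((LQR.Data.posDef_curvature h1.posDef_R τ hP).posSemidef.conj'
      (Kstar - K)).trace_mul_nonneg (hpd hG.1).posSemidef
    have hneg : (Eᵀ * ((Kstar - K) * D.lyap τ Kstar)).trace =
        -(Eᵀ * ((K - Kstar) * D.lyap τ Kstar)).trace := by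
      rw [← neg_sub K Kstar, Matrix.neg_mul, Matrix.mul_neg, Matrix.trace_neg]
    rw [← hE, hneg] at hc
    have hle : D.cost τ K - D.cost τ Kstar ≤
        2 * (Eᵀ * ((K - Kstar) * D.lyap τ Kstar)).trace := by linarith
    calc (D.cost τ K - D.cost τ Kstar) ^ 2
        ≤ (2 * (Eᵀ * ((K - Kstar) * D.lyap τ Kstar)).trace) ^ 2 := by gcongr
      _ = 4 * (Eᵀ * ((K - Kstar) * D.lyap τ Kstar)).trace ^ 2 := by ring
      _ ≤ 4 * ((Eᵀ * E).trace * (((K - Kstar) * D.lyap τ Kstar)ᵀ *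
            ((K - Kstar) * D.lyap τ Kstar)).trace) := by
          gcongr
          exact LQR.sq_trace_transpose_mul_le _ _
      _ ≤ _ := by
          gcongr
          · exact LQR.trace_transpose_mul_self_nonneg E
          · exact LQR.le_lamMax_sq_mul _ hn (hpd hG.1)
  · have h := LQR.lamMin_sq_mul_le E hn (hpd hK)
    rw [Matrix.transpose_smul, Matrix.smul_mul, Matrix.mul_smul, Matrix.trace_smul,
      Matrix.trace_smul, smul_eq_mul, smul_eq_mul]
    linarith
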